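/- Let $X$ be a Fréchet sequence algebra for the coordinatewise product: a linear subspace of $\mathbb C^{\mathbb N}$ (sequences $(x_0,x_1,\dots)$) closed under the coordinatewise product, complete for the topology induced by a non-decreasing separating sequence of seminorms $(\|\cdot\|_q)_{q\ge1}$ with $\|xy\|_q\le\|x\|_q\|y\|_q$ for all $x,y\in X$. Assume that $X$ contains all canonical vectors $e_n$, $n\ge 0$, and that their linear span is dense in $X$. Let $\|\cdot\|$ be an F-norm inducing the topology of $X$, that is, $\|u+v\|\le\|u\|+\|v\|$, $\|cu\|\le\|u\|$ for $|c|\le1$, $\lim_{c\to0}\|cu\|=0$, $\|u\|=0\Rightarrow u=0$, and the sets $\{u:\|u\|<\varepsilon\}$, $\varepsilon>0$, form a base of neighbourhoods of $0$. Let $d\ge1$, $\alpha\in(0,1/d)$, and let $I\subset(0,+\infty)$ be $\sigma$-compact. For $a\in I$ let $w(a)=(w_n(a))_{n\ge1}$ be a sequence of positive reals, with $a\mapsto w_n(a)$ continuous on $I$ for each $n$, such that $B_{w(a)}(x_0,x_1,x_2,\dots)=(w_1(a)x_1,w_2(a)x_2,\dots)$ is a continuous operator from $X$ to $X$. For $\lambda=(\lambda_1,\dots,\lambda_d)\in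 I^d$ put $T_\lambda=B_{w(\lambda_1)}\times\cdots\times B_{w(\lambda_d)}$ on $X^d$, and assume that $(\lambda,v)\mapsto T_\lambda(v)$ is continuous from $I^d\times X^d$ to $X^d$. Suppose that for every integer $m'\ge1$ and every compact $I_0\subset I$ there exist $C_1,C_2>0$, $\beta>\alpha d$, positive numbers $F(n)\le C_1n^\alpha$ ($n\ge1$), an integer $N_0\geq 1$ and $M_0>0$ such that: (i) for all $n\ge N_0$, the map $a\mapsto\sum_{i=1}^n\log w_i(a)$ is $F(n)$-Lipschitz on $I_0$; (ii) $\inf_{a\in I_0}w_1(a)\cdots w_k(a)\to+\infty$ as $k\to+\infty$; (iii) for all $a\in I_0$ and all $n,k\ge N_0$, $$\left\|\frac{\exp\Big(C_2\frac{F(n+k)}{(n+k)^\alpha}k^\alpha\Big)}{w_1(a)\cdots w_k(a)}\,e_k\right\|\le\frac{M_0}{k^\beta}\qquad\text{and}\qquad\left\|\frac{1}{[w_1(a)\cdots w_k(a)]^{1/m'}}\,e_k\right\|\le\frac{M_0}{k^\beta}.$$ Then the family $(T_\lambda)_{\lambda\in I^d}$ admits a common hypercyclic algebra for the coordinatewise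 product: there is a subalgebra $A\ne\{0\}$ of $X^d$ such that for every $u\in A\setminus\{0\}$ and every $\lambda\in I^d$ the orbit $\{T_\lambda^n u:n\ge1\}$ is dense in $X^d$. -/

import Mathlib

open Filter Topology
open scoped BigOperators

noncomputable section

/-- A Fréchet sequence algebra for the coordinatewise product: a linear subspace of the space
`ℕ → ℂ` of all complex sequences, closed under the coordinatewise product, with a non-decreasing
separating sequence of submultiplicative seminorms for which it is complete. (Since the topology
is metrizable, completeness is stated through sequences.) -/
structure FrechetSequenceAlgebra where
  toSubalgebra : NonUnitalSubalgebra ℂ (ℕ → ℂ)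
  seminorm : ℕ → Seminorm ℂ toSubalgebra
  seminorm_mono : Monotone seminorm
  separating : ∀ x, (∀ q, seminorm q x = 0) → x = 0
  seminorm_mul_le : ∀ q x y, seminorm q (x * y) ≤ seminorm q x * seminorm q y
  complete : ∀ u : ℕ → toSubalgebra,
    (∀ q, ∀ ε : ℝ, 0 < ε → ∃ N, ∀ m n, N ≤ m → N ≤ n → seminorm q (u m - u n) < ε) →
    ∃ x, ∀ q, Tendsto (fun n => seminorm q (u n - x)) atTop (𝓝 0)

namespace FrechetSequenceAlgebra

/-- The underlying space of `X`. It is a type synonym, so that it carries the topology given by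
the seminorms and not the topology of coordinatewise convergence. -/
def Carrier (X : FrechetSequenceAlgebra) : Type := X.toSubalgebra

instance : CoeSort FrechetSequenceAlgebra Type := ⟨Carrier⟩

variable (X : FrechetSequenceAlgebra)

instance : NonUnitalCommRing X := inferInstanceAs (NonUnitalCommRing X.toSubalgebra)

instance : Module ℂ X := inferInstanceAs (Module ℂ X.toSubalgebra)

instance : IsScalarTower ℂ X X := inferInstanceAs (IsScalarTower ℂ X.toSubalgebra X.toSubalgebra)

instance : SMulCommClass ℂ X X := inferInstanceAs (SMulCommClass ℂ X.toSubalgebra X.toSubalgebra)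

/-- The defining seminorms, on the underlying space. -/
def seminorms : SeminormFamily ℂ X ℕ := X.seminorm

/-- The topology of `X` is the one induced by the seminorms. -/
instance : TopologicalSpace X := X.seminorms.moduleFilterBasis.topology

theorem withSeminorms : WithSeminorms X.seminorms := ⟨rfl⟩

instance : IsTopologicalAddGroup X := X.withSeminorms.topologicalAddGroup

instance : ContinuousSMul ℂ X := X.withSeminorms.continuousSMul

variable {X}

/-- The sequence `(x₀, x₁, …)` underlying an element `x` of `X`. -/
def toSeq (x : X) : ℕ → ℂ := x.1

/-- The element of `X` given by a sequence that belongs to `X`. -/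
def ofSeq (s : ℕ → ℂ) (hs : s ∈ X.toSubalgebra) : X := ⟨s, hs⟩

/-- The canonical vector `e_n`, when all the canonical vectors belong to `X`. -/
def e (he : ∀ n, Pi.single n (1 : ℂ) ∈ X.toSubalgebra) (n : ℕ) : X :=
  ofSeq (Pi.single n 1) (he n)

variable (X)

/-- `ρ` is an F-norm on `X` which defines the topology of `X`. -/
structure IsFNorm (ρ : X → ℝ) : Prop where
  add_le : ∀ u v, ρ (u + v) ≤ ρ u + ρ v
  smul_le : ∀ (c : ℂ) u, ‖c‖ ≤ 1 → ρ (c • u) ≤ ρ u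
  tendsto_smul : ∀ u, Tendsto (fun c : ℂ => ρ (c • u)) (𝓝 0) (𝓝 0)
  eq_zero : ∀ u, ρ u = 0 → u = 0
  hasBasis_nhds_zero : (𝓝 (0 : X)).HasBasis (fun ε : ℝ => 0 < ε) (fun ε => {u | ρ u < ε})

end FrechetSequenceAlgebra

/-- The weighted backward shift `(x₀, x₁, x₂, …) ↦ (w₁ x₁, w₂ x₂, …)` on all sequences;
the value `w 0` plays no role. -/
def seqShift (w : ℕ → ℝ) (x : ℕ → ℂ) : ℕ → ℂ := fun n => (w (n + 1) : ℂ) * x (n + 1)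

/-- `w` is an admissible weight for `X`: its terms `w₁, w₂, …` are positive and the weighted
backward shift with weight `w` is a continuous linear operator from `X` to `X`. -/
structure Admissible (X : FrechetSequenceAlgebra) (w : ℕ → ℝ) : Prop where
  pos : ∀ n, 1 ≤ n → 0 < w n
  exists_operator : ∃ T : X →L[ℂ] X,
    ∀ x : X, FrechetSequenceAlgebra.toSeq (T x) = seqShift w (FrechetSequenceAlgebra.toSeq x)

/-- The weighted backward shift `B_w : X → X`. -/
def weightedShift {X : FrechetSequenceAlgebra} {w : ℕ → ℝ} (hw : Admissible X w) : X →L[ℂ] X :=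
  hw.exists_operator.choose

theorem toSeq_weightedShift {X : FrechetSequenceAlgebra} {w : ℕ → ℝ} (hw : Admissible X w)
    (x : X) : FrechetSequenceAlgebra.toSeq (weightedShift hw x) =
      seqShift w (FrechetSequenceAlgebra.toSeq x) :=
  hw.exists_operator.choose_spec x

/-- The operator `B_{w(l₁)} × ⋯ × B_{w(l_d)}` on `X^d`. -/
def productShift {X : FrechetSequenceAlgebra} {I : Set ℝ} {w : I → ℕ → ℝ}
    (hw : ∀ a, Admissible X (w a)) {d : ℕ} (l : Fin d → I) : (Fin d → X) →L[ℂ] (Fin d → X) :=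
  ContinuousLinearMap.pi fun i => (weightedShift (hw (l i))).comp (ContinuousLinearMap.proj i)

/-- The set of hypercyclic vectors of `T`: the vectors `x` whose orbit
`{T^n x : n ≥ 1}` is dense. -/
def HC {E : Type*} [TopologicalSpace E] (T : E → E) : Set E :=
  {x | Dense {y | ∃ n : ℕ, 1 ≤ n ∧ T^[n] x = y}}

/-- `A` is a common hypercyclic algebra for the family `T`: it is a subalgebra other than `{0}`,
all of whose nonzero elements are hypercyclic for every member of the family. -/
def IsCommonHypercyclicAlgebra {E Λ : Type*} [NonUnitalCommRing E] [Module ℂ E]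
    [TopologicalSpace E] (T : Λ → E →L[ℂ] E) (A : NonUnitalSubalgebra ℂ E) : Prop :=
  (∃ x ∈ A, x ≠ 0) ∧ ∀ x ∈ A, x ≠ 0 → ∀ l, x ∈ HC (T l)

/-- The product `w₁ ⋯ w_n` of the first `n` weights. -/
def weightProd (w : ℕ → ℝ) (n : ℕ) : ℝ := ∏ i ∈ Finset.Icc 1 n, w i

end

/-!
The algebra is the set of polynomials without constant term in a single vector `u`, found by a
Baire category argument in `X^d`. Up to a scalar, such a polynomial is
`z ^ (m + 1) + ∑ c_q z ^ (m + 2 + q)`. By compactness (`isOpen_setOf_orbit_hits`), the condition that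
for all coefficients in a compact set and all parameters in a compact piece of `I^d` some iterate
brings the polynomial in `u` into a given open set `V` is open. Countably many such conditions
suffice, so that everything rests on their density (`dense_setOf_orbit_hits`).

Given a finitely supported `x` and a finitely supported target `v ∈ V`, a small cube of parameters
is cut into cells, each with a representative `μ_j` and a time `t_j`, and `u` is `x` plus the sum of
the blocks `∑ z_{j,k} e_{t_j + k}`, where `z_{j,k}` is an `(m + 1)`-th root of
`v_k w_1(μ_j) ⋯ w_k(μ_j) / (w_1(μ_j) ⋯ w_{t_j + k}(μ_j))`. The canonical vectors being orthogonal
idempotents, a polynomial in `u` is computed on coefficients (`lowPolyVal_blockSum`), and its lowest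
term dominates on the small coefficients `z_{j,k}`. For a parameter in the cell `j`, the operator
iterated `t_j` times kills `x` and the earlier blocks, carries the block `j` to approximately `v`
when the cell is small compared with `t_j ^ (-α)`, by the Lipschitz condition, and sends a later
block `l` to a vector of size `O((t_l - t_j) ^ (-β))`, by the first estimate of the criterion,
provided that the distance from the parameter to `μ_l` is at most a constant times
`((t_l - t_j) / t_l) ^ α`. The second estimate makes `u - x` small.

It remains to choose cells and times meeting these requirements (`exists_covering_schedule`). The
cube is subdivided `P` times, into `b ^ d` subcubes each time, and the time of a cell is obtained by
reading the list of its subcubes as a number in base `R`. Two cells which separate inside a cube of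
level `g` then have times at least `R ^ g H / 2` apart, for a total duration of order `N = R ^ P H`.
The Hölder condition and the smallness of the cells need `R ^ α < b`, the separation of the times
needs `R ≥ 2 b ^ d`, and the boundedness of the sum of the `(t_l - t_j) ^ (-β)` needs `R ^ β > b ^ d`;
these are compatible since `α d < 1` and `α d < β` (`exists_base_ratio`). The unit `H` is taken large
to make that sum small, and finally `P` is taken large.
-/

/-! ### Numbering the cells of a subdivided cube -/

/-- Vectors of `d` digits in base `b` can be numbered by the integers below `b ^ d`. -/
theorem exists_digit_code (b d : ℕ) : ∃ code : (Fin d → ℕ) → ℕ,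
    (∀ x, (∀ i, x i < b) → code x < b ^ d) ∧
    ∀ x y, (∀ i, x i < b) → (∀ i, y i < b) → code x = code y → x = y := by
  classical
  refine ⟨fun x => if h : ∀ i, x i < b then
    (finFunctionFinEquiv (fun i => (⟨x i, h i⟩ : Fin b)) : ℕ) else 0, ?_, ?_⟩
  · intro x hx
    simp only [hx, implies_true, dite_true]
    exact Fin.is_lt _
  · intro x y hx hy hxy
    simp only [hx, hy, implies_true, dite_true] at hxy
    have := finFunctionFinEquiv.injective (Fin.ext hxy)
    funext i
    simpa using congrFun this i

/-- The cells of a cube cut into `b ^ P` parts along each of its `d` sides can be numbered by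
integers below `R ^ P` in such a way that two cells lying in different blocks of side `b ^ g`
receive numbers more than `R ^ g / 2` apart. The number of a cell is read off in base `R` from its
successive digits in base `b`; since `R` is at least twice the number `b ^ d` of digits, the lower
digits cannot compensate for a higher one. -/
theorem exists_schedule (b d R : ℕ) (hb : 0 < b) (hR : 2 * b ^ d ≤ R) (P : ℕ) :
    ∃ t : (Fin d → ℕ) → ℕ, (∀ x, (∀ i, x i < b ^ P) → t x < R ^ P) ∧
      ∀ g x y, (∀ i, x i < b ^ P) → (∀ i, y i < b ^ P) →
        (∃ i, x i / b ^ g ≠ y i / b ^ g) → (R : ℤ) ^ g + 1 ≤ 2 * |(t x : ℤ) - t y| := by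
  obtain ⟨code, hcode, hinj⟩ := exists_digit_code b d
  induction P with
  | zero =>
    refine ⟨fun _ => 0, by simp, ?_⟩
    rintro g x y hx hy ⟨i, hi⟩
    have h1 := hx i
    have h2 := hy i
    simp only [pow_zero, Nat.lt_one_iff] at h1 h2
    exact absurd (by rw [h1, h2]) hi
  | succ P ih =>
    obtain ⟨t, ht, hsep⟩ := ih
    have hdiv : ∀ x : Fin d → ℕ, (∀ i, x i < b ^ (P + 1)) → ∀ i, x i / b < b ^ P := by
      intro x hx i
      rw [Nat.div_lt_iff_lt_mul hb, ← pow_succ]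
      exact hx i
    have hmod : ∀ x : Fin d → ℕ, ∀ i, x i % b < b := fun x i => Nat.mod_lt _ hb
    refine ⟨fun x => R * t (fun i => x i / b) + code (fun i => x i % b), ?_, ?_⟩
    · intro x hx
      have h1 := ht _ (hdiv x hx)
      have h2 := hcode _ (hmod x)
      calc R * t (fun i => x i / b) + code (fun i => x i % b)
          < R * t (fun i => x i / b) + R := by omega
        _ = R * (t (fun i => x i / b) + 1) := by ring
        _ ≤ R * R ^ P := Nat.mul_le_mul_left _ h1
        _ = R ^ (P + 1) := by ring
    · intro g x y hx hy hne
      have hcx : ((code fun i => x i % b : ℕ) : ℤ) + 1 ≤ (b : ℤ) ^ d := by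
        exact_mod_cast hcode _ (hmod x)
      have hcy : ((code fun i => y i % b : ℕ) : ℤ) + 1 ≤ (b : ℤ) ^ d := by
        exact_mod_cast hcode _ (hmod y)
      have hcx0 : 0 ≤ ((code fun i => x i % b : ℕ) : ℤ) := by positivity
      have hcy0 : 0 ≤ ((code fun i => y i % b : ℕ) : ℤ) := by positivity
      have hR' : 2 * (b : ℤ) ^ d ≤ R := by exact_mod_cast hR
      -- A gap between the coarser cells is multiplied by `R`, and the last digits lose at most
      -- `b ^ d - 1` of it.
      have key : ∀ G : ℤ, G + 1 ≤ 2 * |(t (fun i => x i / b) : ℤ) - t (fun i => y i / b)| →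
          R * G + 2 ≤ 2 * |((R * t (fun i => x i / b) + code (fun i => x i % b) : ℕ) : ℤ)
            - (R * t (fun i => y i / b) + code (fun i => y i % b) : ℕ)| := by
        intro G hG
        push_cast
        generalize ((code fun i => x i % b : ℕ) : ℤ) = p at *
        generalize ((code fun i => y i % b : ℕ) : ℤ) = q at *
        generalize ((t fun i => x i / b : ℕ) : ℤ) = u at *
        generalize ((t fun i => y i / b : ℕ) : ℤ) = v at *
        have hR0 : (0 : ℤ) ≤ R := by positivity
        have h1 : (R : ℤ) * |u - v| = |R * (u - v)| := by rw [abs_mul, abs_of_nonneg hR0]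
        have h2 : |(R : ℤ) * (u - v)| ≤ |R * u + p - (R * v + q)| + |p - q| := by
          have h3 := abs_sub (R * u + p - (R * v + q)) (p - q)
          have e : (R : ℤ) * u + p - (R * v + q) - (p - q) = R * (u - v) := by ring
          rwa [e] at h3
        have h4 : |p - q| ≤ (b : ℤ) ^ d - 1 := by rw [abs_le]; constructor <;> linarith
        have h5 : (R : ℤ) * (G + 1) ≤ R * (2 * |u - v|) := mul_le_mul_of_nonneg_left hG hR0
        linarith
      cases g with
      | zero =>
        by_cases h : ∃ i, x i / b / b ^ 0 ≠ y i / b / b ^ 0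
        · have h1 := key 1 (by simpa using hsep 0 _ _ (hdiv x hx) (hdiv y hy) h)
          have hR0 : (0 : ℤ) ≤ R := by positivity
          simp only [pow_zero]
          linarith
        · push Not at h
          have hq : (fun i => x i / b) = fun i => y i / b := by
            funext i; simpa using h i
          have hc : code (fun i => x i % b) ≠ code (fun i => y i % b) := by
            intro hc
            have hm := hinj _ _ (hmod x) (hmod y) hc
            obtain ⟨i, hi⟩ := hne
            apply hi
            rw [← Nat.div_add_mod (x i) b, ← Nat.div_add_mod (y i) b, congrFun hq i,
              congrFun hm i]
          simp only [hq]
          push_cast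
          rw [add_sub_add_left_eq_sub]
          have : (1 : ℤ) ≤ |((code fun i => x i % b : ℕ) : ℤ) - (code fun i => y i % b : ℕ)| :=
            Int.one_le_abs (sub_ne_zero.mpr (by exact_mod_cast hc))
          simp only [pow_zero]
          linarith
      | succ g =>
        obtain ⟨i, hi⟩ := hne
        have h1 := key _ (hsep g _ _ (hdiv x hx) (hdiv y hy)
          ⟨i, by simpa only [Nat.div_div_eq_div_mul, ← pow_succ'] using hi⟩)
        rw [pow_succ']
        linarith

/-- Two distinct cells have a smallest common block: they lie in the same block of side
`b ^ (g + 1)` and in different blocks of side `b ^ g`, for some `g < P`. -/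
theorem exists_level {b d P : ℕ} {x y : Fin d → ℕ} (hx : ∀ i, x i < b ^ P)
    (hy : ∀ i, y i < b ^ P) (hxy : x ≠ y) :
    ∃ g < P, (∃ i, x i / b ^ g ≠ y i / b ^ g) ∧ ∀ i, x i / b ^ (g + 1) = y i / b ^ (g + 1) := by
  classical
  have hex : ∃ n, ∀ i, x i / b ^ n = y i / b ^ n :=
    ⟨P, fun i => by rw [Nat.div_eq_of_lt (hx i), Nat.div_eq_of_lt (hy i)]⟩
  have hpos : Nat.find hex ≠ 0 := by
    intro h0
    have := Nat.find_spec hex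
    rw [h0] at this
    exact hxy (funext fun i => by simpa using this i)
  obtain ⟨g, hg⟩ := Nat.exists_eq_succ_of_ne_zero hpos
  have hle : Nat.find hex ≤ P := Nat.find_min' hex
    fun i => by rw [Nat.div_eq_of_lt (hx i), Nat.div_eq_of_lt (hy i)]
  refine ⟨g, by omega, ?_, ?_⟩
  · have := Nat.find_min hex (m := g) (by omega)
    push Not at this
    exact this
  · have := Nat.find_spec hex
    rwa [hg] at this

/-- A block of side `b ^ g` contains at most `(b ^ d) ^ g` cells. -/
theorem card_block_le {b d : ℕ} (hb : 0 < b) (S : Finset (Fin d → ℕ)) (g : ℕ) (x : Fin d → ℕ) :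
    (S.filter fun y => ∀ i, x i / b ^ g = y i / b ^ g).card ≤ (b ^ d) ^ g := by
  classical
  calc _ ≤ (Fintype.piFinset fun i => Finset.Ico (b ^ g * (x i / b ^ g))
        (b ^ g * (x i / b ^ g) + b ^ g)).card := by
        refine Finset.card_le_card fun y hy => ?_
        rw [Finset.mem_filter] at hy
        rw [Fintype.mem_piFinset]
        intro i
        rw [Finset.mem_Ico, hy.2 i]
        have h1 := Nat.div_add_mod (y i) (b ^ g)
        have h2 := Nat.mod_lt (y i) (pow_pos hb g)
        constructor <;> linarith [Nat.zero_le (y i % b ^ g)]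
    _ = (b ^ d) ^ g := by
        simp [Fintype.card_piFinset, ← pow_mul, mul_comm]

/-- The sum over all other cells of the `β`-th inverse powers of the gaps is bounded independently of
the number `P` of subdivisions: at most `b ^ (d * (g + 1))` cells leave the block of `x` at level `g`, with a gap of at least
`H R ^ g / 2`,
and the resulting geometric series has ratio `b ^ d / R ^ β < 1`. -/
theorem sum_gap_rpow_le {b d R P H : ℕ} {β : ℝ} (hb : 0 < b) (hβ : 0 < β) (hR : 0 < R)
    (hH : 0 < H) (hRβ : (b : ℝ) ^ d < (R : ℝ) ^ β) {t : (Fin d → ℕ) → ℕ}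
    (ht : ∀ g x y, (∀ i, x i < b ^ P) → (∀ i, y i < b ^ P) →
        (∃ i, x i / b ^ g ≠ y i / b ^ g) → (R : ℤ) ^ g + 1 ≤ 2 * |(t x : ℤ) - t y|)
    (S : Finset (Fin d → ℕ)) (hS : ∀ x ∈ S, ∀ i, x i < b ^ P) (x : Fin d → ℕ) (hx : x ∈ S) :
    ∑ y ∈ S.erase x, 1 / (H * |(t x : ℝ) - t y|) ^ β ≤
      (2 / H) ^ β * b ^ d * (1 - b ^ d / (R : ℝ) ^ β)⁻¹ := by
  classical
  have hR0 : (0 : ℝ) < R := by exact_mod_cast hR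
  have hH0 : (0 : ℝ) < H := by exact_mod_cast hH
  have hRβ0 : 0 < (R : ℝ) ^ β := Real.rpow_pos_of_pos hR0 _
  have hb0 : (0 : ℝ) < (b : ℝ) ^ d := by positivity
  set q : ℝ := b ^ d / (R : ℝ) ^ β with hq
  have hq0 : 0 < q := by positivity
  have hq1 : q < 1 := (div_lt_one hRβ0).2 hRβ
  have hterm : ∀ y ∈ S.erase x, 1 / (H * |(t x : ℝ) - t y|) ^ β ≤
      ∑ g ∈ Finset.range P, if ∀ i, x i / b ^ (g + 1) = y i / b ^ (g + 1)
        then (2 / H) ^ β / ((R : ℝ) ^ β) ^ g else 0 := by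
    intro y hy
    rw [Finset.mem_erase] at hy
    obtain ⟨g, hgP, hne, heq⟩ := exists_level (hS x hx) (hS y hy.2) (Ne.symm hy.1)
    have h1 := ht g x y (hS x hx) (hS y hy.2) hne
    have h2 : (R : ℝ) ^ g + 1 ≤ 2 * |(t x : ℝ) - t y| := by exact_mod_cast h1
    refine le_trans ?_ (Finset.single_le_sum (f := fun g =>
      if ∀ i, x i / b ^ (g + 1) = y i / b ^ (g + 1)
        then (2 / H : ℝ) ^ β / ((R : ℝ) ^ β) ^ g else 0) ?_ (Finset.mem_range.2 hgP))
    · simp only [heq, implies_true, if_true]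
      have h3 : ((R : ℝ) ^ β) ^ g = ((R : ℝ) ^ g) ^ β := by
        rw [← Real.rpow_natCast, ← Real.rpow_natCast, ← Real.rpow_mul hR0.le,
          ← Real.rpow_mul hR0.le, mul_comm]
      rw [h3, ← Real.div_rpow (by positivity) (by positivity), one_div,
        ← Real.inv_rpow (by positivity)]
      refine Real.rpow_le_rpow (by positivity) ?_ hβ.le
      have hRg : (0 : ℝ) < (R : ℝ) ^ g := by positivity
      rw [inv_le_comm₀ (by apply mul_pos hH0; linarith) (by positivity), div_div, inv_div]
      have : (R : ℝ) ^ g ≤ 2 * |(t x : ℝ) - t y| := by linarith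
      calc (H : ℝ) * R ^ g / 2 ≤ H * (2 * |(t x : ℝ) - t y|) / 2 := by gcongr
        _ = _ := by ring
    · intro g _
      split_ifs <;> positivity
  calc _ ≤ ∑ y ∈ S.erase x, ∑ g ∈ Finset.range P,
          (if ∀ i, x i / b ^ (g + 1) = y i / b ^ (g + 1)
            then (2 / H : ℝ) ^ β / ((R : ℝ) ^ β) ^ g else 0) := Finset.sum_le_sum hterm
    _ = ∑ g ∈ Finset.range P, ∑ y ∈ S.erase x,
          (if ∀ i, x i / b ^ (g + 1) = y i / b ^ (g + 1)
            then (2 / H : ℝ) ^ β / ((R : ℝ) ^ β) ^ g else 0) := Finset.sum_comm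
    _ ≤ ∑ g ∈ Finset.range P, (2 / H : ℝ) ^ β * b ^ d * q ^ g := by
        refine Finset.sum_le_sum fun g _ => ?_
        rw [← Finset.sum_filter, Finset.sum_const, nsmul_eq_mul]
        have hc : (((S.erase x).filter fun y => ∀ i, x i / b ^ (g + 1) = y i / b ^ (g + 1)).card
            : ℝ) ≤ ((b : ℝ) ^ d) ^ (g + 1) := by
          exact_mod_cast card_block_le hb (S.erase x) (g + 1) x
        calc _ ≤ ((b : ℝ) ^ d) ^ (g + 1) * ((2 / H : ℝ) ^ β / ((R : ℝ) ^ β) ^ g) := by gcongr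
          _ = _ := by rw [hq, div_pow, pow_succ]; ring
    _ = (2 / H : ℝ) ^ β * b ^ d * ∑ g ∈ Finset.range P, q ^ g := by rw [Finset.mul_sum]
    _ ≤ _ := by
        gcongr
        rw [← tsum_geometric_of_lt_one hq0.le hq1]
        exact (summable_geometric_of_lt_one hq0.le hq1).sum_le_tsum _ (fun i _ => by positivity)

/-- A power `R ≈ b ^ s` with `max d (d / β) < s < 1 / α` and `b` large has all the properties required
of the ratio `R`. Such an `s` exists exactly because `α < 1 / d` and `α * d < β`. -/
theorem exists_base_ratio {d : ℕ} {α β : ℝ} (hd : 1 ≤ d) (hα : 0 < α) (hαd : α < 1 / (d : ℝ))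
    (hβ : α * d < β) : ∃ b R : ℕ, 0 < b ∧ 2 * b ^ d ≤ R ∧ (R : ℝ) ^ α < b ∧
      (b : ℝ) ^ d < (R : ℝ) ^ β := by
  have hd0 : (0 : ℝ) < d := by exact_mod_cast hd
  have hβ0 : 0 < β := lt_trans (by positivity) hβ
  have h1 : max (d : ℝ) (d / β) < 1 / α := by
    apply max_lt
    · rw [lt_div_iff₀ hα]
      rw [lt_div_iff₀ hd0] at hαd
      linarith
    · rw [div_lt_div_iff₀ hβ0 hα]
      linarith
  obtain ⟨s, hs1, hs2⟩ := exists_between h1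
  have hsd : (d : ℝ) < s := (le_max_left _ _).trans_lt hs1
  have hsβ : (d : ℝ) < s * β := by
    have := (le_max_right _ _).trans_lt hs1
    rwa [div_lt_iff₀ hβ0] at this
  have hsα : 0 < 1 - s * α := by
    rw [lt_div_iff₀ hα] at hs2
    linarith
  have hlim : Tendsto (fun b : ℕ => (b : ℝ) ^ (1 - s * α)) atTop atTop :=
    (tendsto_rpow_atTop hsα).comp tendsto_natCast_atTop_atTop
  obtain ⟨b, hbα, hb1⟩ := ((hlim.eventually_gt_atTop ((3 : ℝ) ^ α)).and
    (eventually_ge_atTop 1)).exists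
  have hb1' : (1 : ℝ) ≤ b := by exact_mod_cast hb1
  have hb0 : (0 : ℝ) < b := by linarith
  have hbs : 1 ≤ (b : ℝ) ^ s := Real.one_le_rpow hb1' (by linarith)
  refine ⟨b, ⌈2 * (b : ℝ) ^ s⌉₊, hb1, ?_, ?_, ?_⟩
  · have : (2 * b ^ d : ℝ) ≤ 2 * (b : ℝ) ^ s := by
      rw [← Real.rpow_natCast]
      gcongr
    exact_mod_cast this.trans (Nat.le_ceil _)
  · have h2 : (⌈2 * (b : ℝ) ^ s⌉₊ : ℝ) ≤ 3 * (b : ℝ) ^ s := by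
      have := (Nat.ceil_lt_add_one (show 0 ≤ 2 * (b : ℝ) ^ s by positivity)).le
      linarith
    calc (⌈2 * (b : ℝ) ^ s⌉₊ : ℝ) ^ α ≤ (3 * (b : ℝ) ^ s) ^ α := by gcongr
      _ = 3 ^ α * (b : ℝ) ^ (s * α) := by
          rw [Real.mul_rpow (by norm_num) (by positivity), ← Real.rpow_mul hb0.le]
      _ < (b : ℝ) ^ (1 - s * α) * (b : ℝ) ^ (s * α) := by gcongr
      _ = b := by rw [← Real.rpow_add hb0]; simp
  · calc (b : ℝ) ^ d = 1 * (b : ℝ) ^ (d : ℝ) := by rw [Real.rpow_natCast, one_mul]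
      _ < 2 ^ β * (b : ℝ) ^ (d : ℝ) := by
          gcongr
          exact Real.one_lt_rpow (by norm_num) hβ0
      _ ≤ 2 ^ β * (b : ℝ) ^ (s * β) := by
          gcongr
      _ = (2 * (b : ℝ) ^ s) ^ β := by
          rw [Real.mul_rpow (by norm_num) (by positivity), ← Real.rpow_mul hb0.le]
      _ ≤ _ := by gcongr; exact Nat.le_ceil _

/-! ### Covering a cube of parameters -/

/-- Two reals in the same block of `n` consecutive intervals of length `1 / c` are at distance less
than `n / c`. -/
theorem abs_sub_lt_of_floor_div_eq {r s c : ℝ} {n : ℕ} (hr : 0 ≤ r) (hs : 0 ≤ s) (hc : 0 < c)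
    (hn : 0 < n) (h : ⌊r * c⌋₊ / n = ⌊s * c⌋₊ / n) : |r - s| < n / c := by
  have hn' : (0 : ℝ) < n := by exact_mod_cast hn
  rw [← Nat.floor_div_natCast, ← Nat.floor_div_natCast] at h
  have h1 := Nat.floor_le (show 0 ≤ r * c / n by positivity)
  have h2 := Nat.lt_floor_add_one (r * c / n)
  have h3 := Nat.floor_le (show 0 ≤ s * c / n by positivity)
  have h4 := Nat.lt_floor_add_one (s * c / n)
  rw [h] at h1 h2
  have h5 : |r * c / n - s * c / n| < 1 := by
    rw [abs_lt]; constructor <;> linarith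
  have h6 : r * c / n - s * c / n = (r - s) * (c / n) := by ring
  rw [h6, abs_mul, abs_of_pos (show 0 < c / n by positivity), ← lt_div_iff₀ (by positivity),
    one_div_div] at h5
  exact h5

/-- A small cube of parameters can be cut into cells, with a representative and a time attached to
each cell, such that, for `N` large: the cells have diameter `O(ε / N ^ α)`; the times are between
`N` and `2 N`, at distance at least `N₁` from each other, and so spread out that the `β`-th inverse
powers of the gaps have a small sum; but the time elapsed between two cells controls their distance
in a Hölder way, with exponent `α` and a prescribed constant `C`. The parameters are indexed by a
type `κ`, with coordinates `p`, and the cells by `J`. -/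
theorem exists_covering_schedule {d : ℕ} {α β C : ℝ} (hd : 1 ≤ d) (hα : 0 < α)
    (hαd : α < 1 / (d : ℝ)) (hβ : α * d < β) (hC : 0 < C) :
    ∃ η : ℝ, 0 < η ∧ ∀ {κ : Type} [Nonempty κ] (p : κ → Fin d → ℝ) (a : Fin d → ℝ),
      (∀ k i, p k i ∈ Set.Ico (a i) (a i + η)) → ∀ ε : ℝ, 0 < ε → ∀ N₁ : ℕ,
      ∃ N : ℕ, N₁ ≤ N ∧ 0 < N ∧ ∃ (J : Finset (Fin d → ℕ)) (cell : κ → Fin d → ℕ)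
        (rep : (Fin d → ℕ) → κ) (t : (Fin d → ℕ) → ℕ),
        (∀ k, cell k ∈ J ∧ ∀ i, (N : ℝ) ^ α * |p k i - p (rep (cell k)) i| ≤ ε) ∧
        (∀ j ∈ J, N ≤ t j ∧ t j ≤ 2 * N) ∧
        (∀ j ∈ J, ∀ l ∈ J, j ≠ l → (N₁ : ℤ) ≤ |(t j : ℤ) - t l|) ∧
        (∀ j ∈ J, ∑ l ∈ J.erase j, 1 / |(t j : ℝ) - t l| ^ β ≤ ε) ∧
        (∀ k, ∀ l ∈ J, l ≠ cell k →
          ∀ i, |p k i - p (rep l) i| ≤ C * (|(t (cell k) : ℝ) - t l| / N) ^ α) ∧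
        (J.card : ℝ) / (N : ℝ) ^ β ≤ ε := by
  classical
  have hd0 : (0 : ℝ) < d := by exact_mod_cast hd
  have hβ0 : 0 < β := lt_trans (by positivity) hβ
  obtain ⟨b, R, hb, hbR, hRα, hRβ⟩ := exists_base_ratio hd hα hαd hβ
  have hb0 : (0 : ℝ) < b := by exact_mod_cast hb
  have hR : 0 < R := lt_of_lt_of_le (by positivity) hbR
  have hR0 : (0 : ℝ) < R := by exact_mod_cast hR
  have hRα0 : 0 < (R : ℝ) ^ α := by positivity
  have hRβ0 : 0 < (R : ℝ) ^ β := by positivity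
  refine ⟨C * (1 / 2) ^ α / b, by positivity, ?_⟩
  set η : ℝ := C * (1 / 2) ^ α / b with hη
  have hη0 : 0 < η := by positivity
  intro κ _ p a hp ε hε N₁
  -- The gap unit `H` is fixed first, to make the sums over the gaps small.
  have hlimH : Tendsto (fun H : ℕ => (2 / (H : ℝ)) ^ β * b ^ d * (1 - b ^ d / (R : ℝ) ^ β)⁻¹)
      atTop (𝓝 0) := by
    have h1 : Tendsto (fun H : ℕ => (2 / (H : ℝ)) ^ β) atTop (𝓝 0) := by
      have := (tendsto_const_div_atTop_nhds_zero_nat (2 : ℝ)).rpow_const (p := β) (Or.inr hβ0.le)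
      rwa [Real.zero_rpow hβ0.ne'] at this
    simpa using (h1.mul_const ((b : ℝ) ^ d)).mul_const (1 - b ^ d / (R : ℝ) ^ β)⁻¹
  obtain ⟨H, hHε, hHN⟩ := ((hlimH.eventually_le_const hε).and
    (eventually_ge_atTop (N₁ + 1))).exists
  have hH : 0 < H := by omega
  have hH0 : (0 : ℝ) < H := by exact_mod_cast hH
  -- The number `P` of subdivisions is then taken large.
  have hgeo : ∀ q : ℝ, 0 ≤ q → q < 1 → ∀ c : ℝ,
      ∀ᶠ P : ℕ in atTop, c * q ^ P ≤ ε := by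
    intro q hq0 hq1 c
    have := (tendsto_pow_atTop_nhds_zero_of_lt_one hq0 hq1).const_mul c
    rw [mul_zero] at this
    exact this.eventually_le_const hε
  obtain ⟨P, hP1, hP2⟩ := ((hgeo ((R : ℝ) ^ α / b) (by positivity) ((div_lt_one hb0).2 hRα)
    ((H : ℝ) ^ α * η)).and (hgeo (b ^ d / (R : ℝ) ^ β) (by positivity)
      ((div_lt_one hRβ0).2 hRβ) (1 / (H : ℝ) ^ β))).exists
  obtain ⟨t, htR, ht⟩ := exists_schedule b d R hb hbR P
  have hRP : 0 < R ^ P := by positivity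
  have hswap : ∀ (γ : ℝ) (g : ℕ), ((R : ℝ) ^ g) ^ γ = ((R : ℝ) ^ γ) ^ g := by
    intro γ g
    rw [← Real.rpow_natCast, ← Real.rpow_natCast, ← Real.rpow_mul hR0.le,
      ← Real.rpow_mul hR0.le, mul_comm]
  set c : ℝ := (b : ℝ) ^ P / η with hc
  have hc0 : 0 < c := by positivity
  set cell : κ → Fin d → ℕ := fun k i => ⌊(p k i - a i) * c⌋₊ with hcell
  have hpa : ∀ k i, 0 ≤ p k i - a i := fun k i => by linarith [(hp k i).1]
  have hbox : ∀ k i, cell k i < b ^ P := by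
    intro k i
    rw [hcell]
    dsimp only
    rw [Nat.floor_lt (mul_nonneg (hpa k i) hc0.le), hc]
    have h1 : p k i - a i < η := by linarith [(hp k i).2]
    calc (p k i - a i) * (b ^ P / η) < η * (b ^ P / η) := by gcongr
      _ = ((b ^ P : ℕ) : ℝ) := by push_cast; field_simp
  set J : Finset (Fin d → ℕ) :=
    (Fintype.piFinset fun _ => Finset.range (b ^ P)).filter fun x => ∃ k, cell k = x with hJ
  have hJbox : ∀ x ∈ J, ∀ i, x i < b ^ P := by
    intro x hx i
    rw [hJ, Finset.mem_filter, Fintype.mem_piFinset] at hx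
    exact Finset.mem_range.1 (hx.1 i)
  have hmemJ : ∀ k, cell k ∈ J := by
    intro k
    rw [hJ, Finset.mem_filter, Fintype.mem_piFinset]
    exact ⟨fun i => Finset.mem_range.2 (hbox k i), k, rfl⟩
  have hrep : ∀ x ∈ J, cell (Function.invFun cell x) = x := by
    intro x hx
    rw [hJ, Finset.mem_filter] at hx
    exact Function.invFun_eq hx.2
  have hdist : ∀ k k' g, (∀ i, cell k i / b ^ g = cell k' i / b ^ g) →
      ∀ i, |p k i - p k' i| ≤ (b : ℝ) ^ g / c := by
    intro k k' g h i
    have := (abs_sub_lt_of_floor_div_eq (hpa k i) (hpa k' i) hc0 (pow_pos hb g) (h i)).le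
    rw [sub_sub_sub_cancel_right] at this
    exact_mod_cast this
  have hgap : ∀ j ∈ J, ∀ l ∈ J, ∀ g, (∃ i, j i / b ^ g ≠ l i / b ^ g) →
      (R : ℝ) ^ g + 1 ≤ 2 * |(t j : ℝ) - t l| := by
    intro j hj l hl g h
    exact_mod_cast ht g j l (hJbox j hj) (hJbox l hl) h
  have htime : ∀ j l : Fin d → ℕ, |((H * R ^ P + H * t j : ℕ) : ℝ) - (H * R ^ P + H * t l : ℕ)| =
      H * |(t j : ℝ) - t l| := by
    intro j l
    push_cast
    rw [add_sub_add_left_eq_sub, ← mul_sub, abs_mul, abs_of_pos hH0]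
  refine ⟨H * R ^ P, ?_, by positivity, J, cell, Function.invFun cell,
    fun x => H * R ^ P + H * t x, ?_, ?_, ?_, ?_, ?_, ?_⟩
  · exact le_trans (by omega) (Nat.le_mul_of_pos_right H hRP)
  · refine fun k => ⟨hmemJ k, fun i => ?_⟩
    have h1 := hdist k (Function.invFun cell (cell k)) 0
      (fun i => by rw [hrep _ (hmemJ k)]) i
    push_cast
    rw [Real.mul_rpow hH0.le (by positivity), hswap]
    calc _ ≤ (H : ℝ) ^ α * ((R : ℝ) ^ α) ^ P * (b ^ 0 / c) := by gcongr
      _ = (H : ℝ) ^ α * η * ((R : ℝ) ^ α / b) ^ P := by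
          rw [hc, div_pow]; field_simp
      _ ≤ ε := hP1
  · intro j hj
    have := htR j (hJbox j hj)
    refine ⟨Nat.le_add_right _ _, ?_⟩
    have h2 : H * t j ≤ H * R ^ P := Nat.mul_le_mul_left _ this.le
    dsimp only
    omega
  · intro j hj l hl hjl
    have h1 := ht 0 j l (hJbox j hj) (hJbox l hl) (by
      by_contra hcon
      push Not at hcon
      exact hjl (funext fun i => by simpa using hcon i))
    have h2 : (1 : ℤ) ≤ |(t j : ℤ) - t l| := by
      rw [pow_zero] at h1; linarith
    push_cast
    rw [add_sub_add_left_eq_sub, ← mul_sub, abs_mul, abs_of_nonneg (by positivity)]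
    have h3 : (H : ℤ) * 1 ≤ H * |(t j : ℤ) - t l| := by gcongr
    have h4 : ((N₁ : ℤ) + 1) ≤ H := by exact_mod_cast hHN
    linarith
  · intro j hj
    simp only [htime]
    exact (sum_gap_rpow_le hb hβ0 hR hH hRβ ht J hJbox j hj).trans hHε
  · intro k l hl hlk i
    obtain ⟨g, hgP, hne, heq⟩ := exists_level (hbox k) (hJbox l hl) (Ne.symm hlk)
    have h1 := hdist k (Function.invFun cell l) (g + 1) (fun i => by rw [hrep l hl]; exact heq i) i
    have h2 : (R : ℝ) ^ g ≤ 2 * |(t (cell k) : ℝ) - t l| := by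
      have := hgap _ (hmemJ k) l hl g hne
      linarith
    rw [htime]
    obtain ⟨n, rfl⟩ : ∃ n, P = g + n := ⟨P - g, by omega⟩
    refine h1.trans ?_
    calc (b : ℝ) ^ (g + 1) / c = C * ((1 / 2) ^ α / (b : ℝ) ^ n) := by
          rw [hc, hη]; field_simp; ring
      _ ≤ C * ((1 / 2) ^ α / ((R : ℝ) ^ α) ^ n) := by gcongr
      _ = C * ((R : ℝ) ^ g / 2 * H / (H * (R : ℝ) ^ (g + n))) ^ α := by
          congr 1
          rw [← hswap, ← Real.div_rpow (by positivity) (by positivity)]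
          congr 1
          field_simp
          ring
      _ ≤ _ := by
          push_cast
          gcongr C * ((?_) / _) ^ α
          nlinarith
  · have h1 : J.card ≤ (b ^ d) ^ P := by
      calc J.card ≤ (Fintype.piFinset fun _ : Fin d => Finset.range (b ^ P)).card :=
            Finset.card_filter_le _ _
        _ = (b ^ d) ^ P := by simp [Fintype.card_piFinset, ← pow_mul, mul_comm]
    have h2 : (J.card : ℝ) ≤ ((b : ℝ) ^ d) ^ P := by exact_mod_cast h1
    push_cast
    rw [Real.mul_rpow hH0.le (by positivity), hswap]
    calc _ ≤ ((b : ℝ) ^ d) ^ P / ((H : ℝ) ^ β * ((R : ℝ) ^ β) ^ P) := by gcongr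
      _ = 1 / (H : ℝ) ^ β * (b ^ d / (R : ℝ) ^ β) ^ P := by rw [div_pow]; field_simp
      _ ≤ ε := hP2

/-! ### Topology of Fréchet sequence algebras and F-norms -/

namespace FrechetSequenceAlgebra

variable {X : FrechetSequenceAlgebra}

theorem toSeq_injective : Function.Injective (toSeq : X → ℕ → ℂ) := Subtype.val_injective

theorem toSeq_add (x y : X) : toSeq (x + y) = toSeq x + toSeq y := rfl

theorem toSeq_smul (c : ℂ) (x : X) : toSeq (c • x) = c • toSeq x := rfl

theorem toSeq_mul (x y : X) : toSeq (x * y) = toSeq x * toSeq y := rfl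

theorem toSeq_zero : toSeq (0 : X) = 0 := rfl

theorem toSeq_e (he : ∀ n, Pi.single n (1 : ℂ) ∈ X.toSubalgebra) (n : ℕ) :
    toSeq (e he n) = Pi.single n 1 := rfl

theorem toSeq_sum {ι : Type*} (s : Finset ι) (f : ι → X) :
    toSeq (∑ i ∈ s, f i) = ∑ i ∈ s, toSeq (f i) :=
  map_sum (AddMonoidHom.mk' (toSeq : X → ℕ → ℂ) toSeq_add) f s

instance : IsTopologicalRing X := by
  have hcont : ∀ q, Continuous (X.seminorms q) := fun q => X.withSeminorms.continuous_seminorm q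
  have h0 : ∀ q, Tendsto (X.seminorms q) (𝓝 0) (𝓝 0) := fun q => by
    simpa using (hcont q).tendsto 0
  have hmul : ∀ q (x y : X), X.seminorms q (x * y) ≤ X.seminorms q x * X.seminorms q y :=
    fun q x y => X.seminorm_mul_le q x y
  refine IsTopologicalRing.of_addGroup_of_nhds_zero ?_ (fun x => ?_) (fun x => ?_)
  · rw [X.withSeminorms.tendsto_nhds]
    intro q ε hε
    have h1 : Tendsto (fun z : X × X => X.seminorms q z.1 * X.seminorms q z.2)
        (𝓝 0 ×ˢ 𝓝 0) (𝓝 (0 * 0)) :=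
      ((h0 q).comp tendsto_fst).mul ((h0 q).comp tendsto_snd)
    rw [mul_zero] at h1
    filter_upwards [h1.eventually_lt_const hε] with z hz
    rw [sub_zero]
    exact (hmul q _ _).trans_lt hz
  · rw [X.withSeminorms.tendsto_nhds]
    intro q ε hε
    have h1 := (h0 q).const_mul (X.seminorms q x)
    rw [mul_zero] at h1
    filter_upwards [h1.eventually_lt_const hε] with z hz
    rw [sub_zero]
    exact (hmul q _ _).trans_lt hz
  · rw [X.withSeminorms.tendsto_nhds]
    intro q ε hε
    have h1 := (h0 q).mul_const (X.seminorms q x)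
    rw [zero_mul] at h1
    filter_upwards [h1.eventually_lt_const hε] with z hz
    rw [sub_zero]
    exact (hmul q _ _).trans_lt hz

/-- The seminorms separate points. -/
theorem t1Space : T1Space X :=
  X.withSeminorms.T1_of_separating fun x hx => by
    by_contra h
    push Not at h
    exact hx (X.separating x h)

/-- A power of `X` is a Baire space, because `X` is completely metrizable. -/
theorem baireSpace_pi (ι : Type*) [Fintype ι] : BaireSpace (ι → X) := by
  let _ : UniformSpace X := IsTopologicalAddGroup.rightUniformSpace X
  have : IsUniformAddGroup X := isUniformAddGroup_of_addCommGroup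
  have : FirstCountableTopology X := X.withSeminorms.firstCountableTopology
  have : (uniformity X).IsCountablyGenerated := IsUniformAddGroup.uniformity_countably_generated
  have : CompleteSpace X := by
    refine UniformSpace.complete_of_cauchySeq_tendsto fun u hu => ?_
    obtain ⟨x, hx⟩ := X.complete u (by
      intro q ε hε
      have h1 : Tendsto (fun z : ℕ × ℕ => u z.1 - u z.2) (atTop ×ˢ atTop) (𝓝 0) := by
        have := hu.tendsto_uniformity
        rw [uniformity_eq_comap_nhds_zero_swapped, tendsto_comap_iff, ← prod_atTop_atTop_eq] at this
        exact this
      have h2 := (X.withSeminorms.tendsto_nhds _ _).1 h1 q ε hε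
      rw [prod_atTop_atTop_eq, eventually_atTop] at h2
      obtain ⟨⟨a, b⟩, h⟩ := h2
      refine ⟨max a b, fun m n hm hn => ?_⟩
      have := h (m, n) ⟨(le_max_left _ _).trans hm, (le_max_right _ _).trans hn⟩
      rwa [sub_zero] at this)
    refine ⟨x, (X.withSeminorms.tendsto_nhds u (x : X)).2 ?_⟩
    exact fun q ε hε => (hx q).eventually_lt_const hε
  infer_instance

theorem secondCountableTopology (he : ∀ n, Pi.single n (1 : ℂ) ∈ X.toSubalgebra)
    (hdense : Dense (Submodule.span ℂ (Set.range (e he)) : Set X)) :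
    SecondCountableTopology X := by
  let _ : UniformSpace X := IsTopologicalAddGroup.rightUniformSpace X
  have : IsUniformAddGroup X := isUniformAddGroup_of_addCommGroup
  have : FirstCountableTopology X := X.withSeminorms.firstCountableTopology
  have : (uniformity X).IsCountablyGenerated := IsUniformAddGroup.uniformity_countably_generated
  have : TopologicalSpace.SeparableSpace X := by
    rw [← TopologicalSpace.isSeparable_univ_iff, ← hdense.closure_eq]
    exact ((Set.countable_range _).isSeparable.span (R := ℂ)).closure
  exact UniformSpace.secondCountable_of_separable X

theorem IsFNorm.map_zero {ρ : X → ℝ} (hρ : X.IsFNorm ρ) : ρ 0 = 0 := by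
  have := hρ.tendsto_smul 0
  simp only [smul_zero] at this
  exact tendsto_nhds_unique tendsto_const_nhds this

theorem IsFNorm.sum_le {ρ : X → ℝ} (hρ : X.IsFNorm ρ) {ι : Type*} (s : Finset ι) (f : ι → X) :
    ρ (∑ i ∈ s, f i) ≤ ∑ i ∈ s, ρ (f i) :=
  Finset.le_sum_of_subadditive ρ hρ.map_zero.le hρ.add_le s f

theorem IsFNorm.smul_le_smul {ρ : X → ℝ} (hρ : X.IsFNorm ρ) {a b : ℂ} (h : ‖a‖ ≤ ‖b‖) (x : X) :
    ρ (a • x) ≤ ρ (b • x) := by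
  rcases eq_or_ne b 0 with rfl | hb
  · have : a = 0 := by simpa using h
    rw [this]
  · have := hρ.smul_le (a / b) (b • x) (by
      rw [norm_div]; exact (div_le_one (norm_pos_iff.2 hb)).2 h)
    rwa [smul_smul, div_mul_cancel₀ _ hb] at this

theorem IsFNorm.natCast_smul_le {ρ : X → ℝ} (hρ : X.IsFNorm ρ) (n : ℕ) (x : X) :
    ρ ((n : ℂ) • x) ≤ n * ρ x := by
  induction n with
  | zero => simp [hρ.map_zero]
  | succ n ih =>
    push_cast
    rw [add_smul, one_smul]
    linarith [hρ.add_le ((n : ℂ) • x) x]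

/-- Lack of homogeneity costs only a rounding: the scalars are compared up to an integer factor. -/
theorem IsFNorm.smul_le_natCast_mul {ρ : X → ℝ} (hρ : X.IsFNorm ρ) {a b : ℂ} {n : ℕ}
    (h : ‖a‖ ≤ n * ‖b‖) (x : X) : ρ (a • x) ≤ n * ρ (b • x) := by
  refine (hρ.smul_le_smul (b := n * b) (by simpa using h) x).trans ?_
  rw [mul_smul]
  exact hρ.natCast_smul_le n _

theorem IsFNorm.exists_smul_le {ρ : X → ℝ} (hρ : X.IsFNorm ρ) (x : X) {ε : ℝ} (hε : 0 < ε) :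
    ∃ δ : ℝ, 0 < δ ∧ ∀ c : ℂ, ‖c‖ ≤ δ → ρ (c • x) ≤ ε := by
  obtain ⟨δ, hδ, h⟩ := Metric.eventually_nhds_iff_ball.1
    ((hρ.tendsto_smul x).eventually_le_const hε)
  exact ⟨δ / 2, by linarith, fun c hc => h c (by rw [mem_ball_zero_iff]; linarith)⟩

theorem IsFNorm.exists_ball_pi {ρ : X → ℝ} (hρ : X.IsFNorm ρ) {ι : Type*} [Fintype ι]
    {V : Set (ι → X)} (hV : IsOpen V) {v : ι → X} (hv : v ∈ V) :
    ∃ ε : ℝ, 0 < ε ∧ ∀ y : ι → X, (∀ i, ρ (y i - v i) < ε) → y ∈ V := by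
  obtain ⟨U, hU, hUV⟩ := isOpen_pi_iff'.1 hV v hv
  have h1 : ∀ i, ∃ ε : ℝ, 0 < ε ∧ ∀ y : X, ρ (y - v i) < ε → y ∈ U i := by
    intro i
    have h2 : ∀ᶠ x in 𝓝 (0 : X), x + v i ∈ U i := by
      have : Tendsto (fun x : X => x + v i) (𝓝 0) (𝓝 (0 + v i)) :=
        (continuous_id.add continuous_const).tendsto 0
      rw [zero_add] at this
      exact this.eventually ((hU i).1.mem_nhds (hU i).2)
    obtain ⟨ε, hε, h⟩ := hρ.hasBasis_nhds_zero.eventually_iff.1 h2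
    exact ⟨ε, hε, fun y hy => by simpa using h hy⟩
  choose ε hε h using h1
  obtain ⟨δ, hδ0, hδ⟩ : ∃ δ : ℝ, 0 < δ ∧ ∀ i, δ ≤ ε i := by
    have := (Set.finite_univ : (Set.univ : Set ι).Finite).image ε
    obtain hι | hι := isEmpty_or_nonempty ι
    · exact ⟨1, one_pos, fun i => hι.elim i⟩
    · obtain ⟨i, hi⟩ := Finite.exists_min ε
      exact ⟨ε i, hε i, hi⟩
  exact ⟨δ, hδ0, fun y hy => hUV fun i _ => h i _ ((hy i).trans_le (hδ i))⟩

/-- The vectors of finite support are dense in `X^d`. -/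
theorem exists_finite_support_mem (he : ∀ n, Pi.single n (1 : ℂ) ∈ X.toSubalgebra)
    (hdense : Dense (Submodule.span ℂ (Set.range (e he)) : Set X)) {ι : Type*} [Fintype ι]
    {V : Set (ι → X)} (hV : IsOpen V) (hne : V.Nonempty) :
    ∃ (v : ι → ℕ → ℂ) (L₀ : ℕ), ∀ L, L₀ ≤ L →
      (fun i => ∑ k ∈ Finset.range L, v i k • e he k) ∈ V := by
  have h1 : Dense (Set.pi Set.univ fun _ : ι => (Submodule.span ℂ (Set.range (e he)) : Set X)) :=
    dense_pi _ fun i _ => hdense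
  obtain ⟨y, hyV, hy⟩ := h1.exists_mem_open hV hne
  have h2 : ∀ i, ∃ c : ℕ →₀ ℂ, (c.sum fun n a => a • e he n) = y i := fun i =>
    Finsupp.mem_span_range_iff_exists_finsupp.1 (hyV i trivial)
  choose c hc using h2
  refine ⟨fun i => c i, (Finset.univ.biUnion fun i => (c i).support).sup id + 1, fun L hL => ?_⟩
  convert hy using 1
  funext i
  rw [← hc i, Finsupp.sum_of_support_subset (s := Finset.range L) _ _ _ (by simp)]
  intro n hn
  have : n ≤ (Finset.univ.biUnion fun i => (c i).support).sup id :=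
    Finset.le_sup (f := id) (Finset.mem_biUnion.2 ⟨i, Finset.mem_univ i, hn⟩)
  exact Finset.mem_range.2 (by omega)

end FrechetSequenceAlgebra

/-! ### Polynomials and powers of weighted shifts -/

theorem weightProd_pos {w : ℕ → ℝ} (hw : ∀ n, 1 ≤ n → 0 < w n) (n : ℕ) : 0 < weightProd w n :=
  Finset.prod_pos fun i hi => hw i (Finset.mem_Icc.1 hi).1

theorem weightProd_succ (w : ℕ → ℝ) (n : ℕ) :
    weightProd w (n + 1) = weightProd w n * w (n + 1) := by
  rw [weightProd, weightProd, Finset.prod_Icc_succ_top (by omega)]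

theorem log_weightProd {w : ℕ → ℝ} (hw : ∀ n, 1 ≤ n → 0 < w n) (n : ℕ) :
    Real.log (weightProd w n) = ∑ i ∈ Finset.Icc 1 n, Real.log (w i) :=
  Real.log_prod fun i hi => (hw i (Finset.mem_Icc.1 hi).1).ne'

/-- The polynomial `z ^ (m + 1) + ∑ c_q z ^ (m + 2 + q)`: its lowest term is `z ^ (m + 1)`. -/
def lowPoly (m : ℕ) {M : ℕ} (c : Fin M → ℂ) (z : ℂ) : ℂ :=
  z ^ (m + 1) + ∑ q : Fin M, c q * z ^ (m + 2 + q)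

theorem lowPoly_zero (m : ℕ) {M : ℕ} (c : Fin M → ℂ) : lowPoly m c 0 = 0 := by
  simp [lowPoly]

theorem lowPoly_eq_mul (m : ℕ) {M : ℕ} (c : Fin M → ℂ) (z : ℂ) :
    lowPoly m c z = z ^ (m + 1) * (1 + ∑ q : Fin M, c q * z ^ (1 + (q : ℕ))) := by
  rw [lowPoly, mul_add, mul_one, Finset.mul_sum]
  congr 1
  refine Finset.sum_congr rfl fun q _ => ?_
  rw [show m + 2 + (q : ℕ) = (m + 1) + (1 + q) by ring, pow_add]
  ring

/-- Near `0`, a polynomial with coefficients bounded by `K` is its lowest term up to a relative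
error `K * M * ‖z‖`. -/
theorem exists_lowPoly_eq {m M : ℕ} {K : ℝ} {c : Fin M → ℂ} (hc : ∀ q, ‖c q‖ ≤ K) (hK : 0 ≤ K)
    {z : ℂ} (hz : ‖z‖ ≤ 1) :
    ∃ h : ℂ, lowPoly m c z = z ^ (m + 1) * (1 + h) ∧ ‖h‖ ≤ M * (K * ‖z‖) := by
  refine ⟨_, lowPoly_eq_mul m c z, (norm_sum_le _ _).trans ?_⟩
  calc ∑ q : Fin M, ‖c q * z ^ (1 + (q : ℕ))‖ ≤ ∑ _q : Fin M, K * ‖z‖ := by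
        refine Finset.sum_le_sum fun q _ => ?_
        rw [norm_mul, norm_pow]
        gcongr
        · exact hc q
        · exact pow_le_of_le_one (norm_nonneg z) hz (by omega)
    _ = M * (K * ‖z‖) := by simp

namespace FrechetSequenceAlgebra

variable {X : FrechetSequenceAlgebra}

/-- The power `x ^ (n + 1)` in the non-unital algebra `X`. -/
def powSucc (x : X) : ℕ → X
  | 0 => x
  | n + 1 => powSucc x n * x

theorem toSeq_powSucc (x : X) (n k : ℕ) : toSeq (powSucc x n) k = toSeq x k ^ (n + 1) := by
  induction n with
  | zero => simp [powSucc]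
  | succ n ih => rw [powSucc, toSeq_mul, Pi.mul_apply, ih, ← pow_succ]

theorem continuous_powSucc (n : ℕ) : Continuous fun x : X => powSucc x n := by
  induction n with
  | zero => exact continuous_id
  | succ n ih => exact ih.mul continuous_id

/-- The value of the polynomial `lowPoly m c` at an element of `X`. -/
def lowPolyVal (m : ℕ) {M : ℕ} (c : Fin M → ℂ) (x : X) : X :=
  powSucc x m + ∑ q : Fin M, c q • powSucc x (m + 1 + q)

theorem toSeq_lowPolyVal (m : ℕ) {M : ℕ} (c : Fin M → ℂ) (x : X) (k : ℕ) :
    toSeq (lowPolyVal m c x) k = lowPoly m c (toSeq x k) := by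
  rw [lowPolyVal, toSeq_add, toSeq_sum, Pi.add_apply, Finset.sum_apply, toSeq_powSucc, lowPoly]
  congr 1
  refine Finset.sum_congr rfl fun q _ => ?_
  rw [toSeq_smul, Pi.smul_apply, toSeq_powSucc, smul_eq_mul]
  congr 2
  ring

theorem continuous_lowPolyVal (m M : ℕ) :
    Continuous fun z : (Fin M → ℂ) × X => lowPolyVal m z.1 z.2 := by
  unfold lowPolyVal
  refine ((continuous_powSucc m).comp continuous_snd).add (continuous_finsetSum _ fun q _ => ?_)
  exact ((continuous_apply q).comp continuous_fst).smul
    ((continuous_powSucc _).comp continuous_snd)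

variable (he : ∀ n, Pi.single n (1 : ℂ) ∈ X.toSubalgebra)

/-- Canonical vectors are orthogonal idempotents, so a polynomial without constant term acts on
the coefficients. -/
theorem lowPolyVal_sum {ι : Type*} (s : Finset ι) (f : ι → ℕ) (hf : Set.InjOn f s) (a : ι → ℂ)
    (m : ℕ) {M : ℕ} (c : Fin M → ℂ) :
    lowPolyVal m c (∑ i ∈ s, a i • e he (f i)) = ∑ i ∈ s, lowPoly m c (a i) • e he (f i) := by
  classical
  have hcoord : ∀ (b : ι → ℂ) (n : ℕ), toSeq (∑ i ∈ s, b i • e he (f i)) n =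
      ∑ i ∈ s, if f i = n then b i else 0 := by
    intro b n
    rw [toSeq_sum, Finset.sum_apply]
    refine Finset.sum_congr rfl fun i _ => ?_
    rw [toSeq_smul, toSeq_e, Pi.smul_apply, Pi.single_apply, smul_eq_mul, mul_ite, mul_one,
      mul_zero]
    simp only [eq_comm]
  refine toSeq_injective (funext fun n => ?_)
  rw [toSeq_lowPolyVal, hcoord, hcoord]
  by_cases h : ∃ i ∈ s, f i = n
  · obtain ⟨i, hi, rfl⟩ := h
    have hne : ∀ j ∈ s, j ≠ i → f j ≠ f i := fun j hj hji h => hji (hf hj hi h)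
    rw [Finset.sum_eq_single_of_mem i hi fun j hj hji => if_neg (hne j hj hji),
      Finset.sum_eq_single_of_mem i hi fun j hj hji => if_neg (hne j hj hji), if_pos rfl,
      if_pos rfl]
  · push Not at h
    rw [Finset.sum_eq_zero fun i hi => if_neg (h i hi),
      Finset.sum_eq_zero fun i hi => if_neg (h i hi), lowPoly_zero]

theorem weightedShift_e_zero {w : ℕ → ℝ} (hw : Admissible X w) :
    weightedShift hw (e he 0) = 0 := by
  refine toSeq_injective (funext fun n => ?_)
  rw [toSeq_weightedShift, toSeq_e, toSeq_zero]
  simp [seqShift]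

theorem weightedShift_e_succ {w : ℕ → ℝ} (hw : Admissible X w) (k : ℕ) :
    weightedShift hw (e he (k + 1)) = (w (k + 1) : ℂ) • e he k := by
  refine toSeq_injective (funext fun n => ?_)
  rw [toSeq_weightedShift, toSeq_smul, toSeq_e, toSeq_e]
  by_cases h : n = k
  · subst h; simp [seqShift]
  · simp [seqShift, h]

theorem weightedShift_pow_e {w : ℕ → ℝ} (hw : Admissible X w) (N k : ℕ) :
    (weightedShift hw ^ N) (e he (N + k)) =
      ((weightProd w (N + k) / weightProd w k : ℝ) : ℂ) • e he k := by
  induction N with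
  | zero => simp [(weightProd_pos hw.pos k).ne']
  | succ N ih =>
    rw [pow_succ, mul_apply_eq_comp, show N + 1 + k = N + k + 1 by ring,
      weightedShift_e_succ, map_smul, ih, smul_smul, weightProd_succ]
    congr 1
    push_cast
    ring

theorem weightedShift_pow_e_of_lt {w : ℕ → ℝ} (hw : Admissible X w) {N k : ℕ} (h : k < N) :
    (weightedShift hw ^ N) (e he k) = 0 := by
  obtain ⟨n, rfl⟩ := Nat.exists_eq_add_of_lt h
  have h1 := weightedShift_pow_e he hw k 0
  rw [add_zero] at h1
  rw [show k + n + 1 = n + 1 + k by ring, pow_add, mul_apply_eq_comp, h1, map_smul,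
    pow_succ, mul_apply_eq_comp, weightedShift_e_zero, map_zero, smul_zero]

end FrechetSequenceAlgebra

theorem iterate_productShift_apply {X : FrechetSequenceAlgebra} {I : Set ℝ} {w : I → ℕ → ℝ}
    (hw : ∀ a, Admissible X (w a)) {d : ℕ} (l : Fin d → I) (N : ℕ) (u : Fin d → X) (i : Fin d) :
    (productShift hw l)^[N] u i = (weightedShift (hw (l i)) ^ N) (u i) := by
  induction N generalizing u with
  | zero => rfl
  | succ N ih =>
    rw [Function.iterate_succ_apply, ih, pow_succ, mul_apply_eq_comp]
    rfl

/-! ### Comparison of weights and block vectors -/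

/-- Products of weights are compared through the sums of their logarithms. -/
theorem weightProd_le_exp_mul {w w' : ℕ → ℝ} (hw : ∀ n, 1 ≤ n → 0 < w n)
    (hw' : ∀ n, 1 ≤ n → 0 < w' n) {n : ℕ} {s : ℝ}
    (h : |∑ i ∈ Finset.Icc 1 n, Real.log (w i) - ∑ i ∈ Finset.Icc 1 n, Real.log (w' i)| ≤ s) :
    weightProd w n ≤ Real.exp s * weightProd w' n := by
  rw [← log_weightProd hw, ← log_weightProd hw'] at h
  rw [← Real.exp_log (weightProd_pos hw n), ← Real.exp_log (weightProd_pos hw' n), ← Real.exp_add]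
  exact Real.exp_le_exp.2 (by linarith [(abs_le.1 h).2])

/-- If the products of the first `k` and of the first `n` weights are almost the same for `w` and `w'`,
then the vector prepared for `w'` is carried by the shift with weight `w` almost onto its target
`v`, a perturbation by the relative error `h` included. -/
theorem norm_mul_weight_ratio_sub_le {w w' : ℕ → ℝ} (hw : ∀ n, 1 ≤ n → 0 < w n)
    (hw' : ∀ n, 1 ≤ n → 0 < w' n) {n k : ℕ} {τ : ℝ} (hτ : τ ≤ 1)
    (h1 : |Real.log (weightProd w n) - Real.log (weightProd w' n)| ≤ τ / 2)
    (h2 : |Real.log (weightProd w k) - Real.log (weightProd w' k)| ≤ τ / 2)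
    {v h : ℂ} (hh : ‖h‖ ≤ τ) :
    ‖v * ((weightProd w' k / weightProd w' n : ℝ) : ℂ) * (1 + h) *
      ((weightProd w n / weightProd w k : ℝ) : ℂ) - v‖ ≤ ‖v‖ * (5 * τ) := by
  set s : ℝ := (Real.log (weightProd w n) - Real.log (weightProd w' n)) -
    (Real.log (weightProd w k) - Real.log (weightProd w' k)) with hs
  have hsτ : |s| ≤ τ := by
    refine (abs_sub _ _).trans ?_
    linarith
  have hexp : (weightProd w' k / weightProd w' n) * (weightProd w n / weightProd w k) =
      Real.exp s := by
    rw [hs, Real.exp_sub, Real.exp_sub, Real.exp_sub, Real.exp_log (weightProd_pos hw n),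
      Real.exp_log (weightProd_pos hw k), Real.exp_log (weightProd_pos hw' n),
      Real.exp_log (weightProd_pos hw' k)]
    have a1 := (weightProd_pos hw n).ne'
    have a2 := (weightProd_pos hw k).ne'
    have a3 := (weightProd_pos hw' n).ne'
    have a4 := (weightProd_pos hw' k).ne'
    field_simp
  have e1 : v * ((weightProd w' k / weightProd w' n : ℝ) : ℂ) * (1 + h) *
      ((weightProd w n / weightProd w k : ℝ) : ℂ) - v =
      v * (((Real.exp s - 1 : ℝ) : ℂ) + (Real.exp s : ℂ) * h) := by
    rw [← hexp]; push_cast; ring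
  have e2 : |Real.exp s - 1| ≤ 2 * |s| := Real.abs_exp_sub_one_le (hsτ.trans hτ)
  have e3 : |Real.exp s| ≤ 3 := by
    have := abs_sub_abs_le_abs_sub (Real.exp s) 1
    rw [abs_one] at this
    linarith
  have hτ0 : 0 ≤ τ := (norm_nonneg h).trans hh
  rw [e1, norm_mul]
  gcongr
  refine (norm_add_le _ _).trans ?_
  rw [norm_mul, Complex.norm_real, Complex.norm_real, Real.norm_eq_abs, Real.norm_eq_abs]
  have : |Real.exp s| * ‖h‖ ≤ 3 * τ := mul_le_mul e3 hh (norm_nonneg h) (by norm_num)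
  linarith

/-- The Hölder condition of the schedule is what the criterion asks for: with `n = n₁ + k` and
`f = F n`, if the distance `x` of two parameters is small compared with `(k / n) ^ α`, then the
factor `exp (F n * x)`, by which their products of `n` weights differ at most, is absorbed by the
exponential factor of the criterion. -/
theorem exp_mul_le_exp_criterion {f x C₂ α N g : ℝ} {n₁ k : ℕ} (hf : 0 < f) (hC : 0 < C₂)
    (hα : 0 < α) (hg : 0 < g) (hgk : g ≤ k) (hN : 0 < N) (hn : (n₁ : ℝ) + k ≤ 3 * N)
    (hx : x ≤ C₂ / 3 ^ α * (g / N) ^ α) :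
    Real.exp (f * x) ≤ Real.exp (C₂ * (f / ((n₁ : ℝ) + k) ^ α) * (k : ℝ) ^ α) := by
  have hk : (0 : ℝ) < k := hg.trans_le hgk
  have hnk : (0 : ℝ) < (n₁ : ℝ) + k := by positivity
  apply Real.exp_le_exp.2
  calc f * x ≤ f * (C₂ / 3 ^ α * (g / N) ^ α) := by gcongr
    _ = C₂ * f * (g / (3 * N)) ^ α := by
        rw [Real.div_rpow hg.le hN.le, Real.div_rpow hg.le (by positivity),
          Real.mul_rpow (by norm_num) hN.le]
        field_simp
    _ ≤ C₂ * f * (k / (n₁ + k)) ^ α := by gcongr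
    _ = _ := by
        rw [Real.div_rpow hk.le hnk.le]
        field_simp

namespace FrechetSequenceAlgebra

variable {X : FrechetSequenceAlgebra} (he : ∀ n, Pi.single n (1 : ℂ) ∈ X.toSubalgebra)

/-- The vector made of the blocks `∑ k < L, y j k • e (t j + k)`, `j ∈ J`. -/
def blockSum {ι : Type*} (J : Finset ι) (t : ι → ℕ) (L : ℕ) (y : ι → ℕ → ℂ) : X :=
  ∑ j ∈ J, ∑ k ∈ Finset.range L, y j k • e he (t j + k)

/-- A polynomial without constant term acts separately on the coefficients of disjoint blocks. -/
theorem lowPolyVal_blockSum {ι : Type*} {J : Finset ι} {t : ι → ℕ} {L : ℕ}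
    (hsep : ∀ j ∈ J, ∀ l ∈ J, j ≠ l → (L : ℤ) ≤ |(t j : ℤ) - t l|) (y : ι → ℕ → ℂ)
    (m : ℕ) {M : ℕ} (c : Fin M → ℂ) :
    lowPolyVal m c (blockSum he J t L y) = blockSum he J t L fun j k => lowPoly m c (y j k) := by
  unfold blockSum
  rw [← Finset.sum_product', ← Finset.sum_product']
  refine lowPolyVal_sum he _ (fun s : ι × ℕ => t s.1 + s.2) ?_ _ m c
  rintro ⟨j, k⟩ hjk ⟨l, k'⟩ hlk h
  rw [Finset.mem_coe, Finset.mem_product, Finset.mem_range] at hjk hlk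
  dsimp only at hjk hlk h
  by_cases hjl : j = l
  · subst hjl
    rw [Nat.add_left_cancel h]
  · have h1 := hsep j hjk.1 l hlk.1 hjl
    rw [le_abs] at h1
    omega

/-- Applying a shift `t j` times to a block vector brings the block `j` to the origin, kills the
earlier blocks and leaves later blocks far away. -/
theorem weightedShift_pow_blockSum {w : ℕ → ℝ} (hw : Admissible X w) {ι : Type*} [DecidableEq ι]
    {J : Finset ι} {t : ι → ℕ} {L : ℕ}
    (hsep : ∀ j ∈ J, ∀ l ∈ J, j ≠ l → (L : ℤ) ≤ |(t j : ℤ) - t l|) (y : ι → ℕ → ℂ)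
    {j : ι} (hj : j ∈ J) :
    (weightedShift hw ^ t j) (blockSum he J t L y) =
      ∑ k ∈ Finset.range L,
        (y j k * ((weightProd w (t j + k) / weightProd w k : ℝ) : ℂ)) • e he k +
      ∑ l ∈ J.erase j, ∑ k ∈ Finset.range L, if t j < t l then
        (y l k * ((weightProd w (t l + k) / weightProd w (t l - t j + k) : ℝ) : ℂ)) •
          e he (t l - t j + k) else 0 := by
  unfold blockSum
  rw [map_sum, ← Finset.add_sum_erase _ _ hj]
  congr 1
  · rw [map_sum]
    refine Finset.sum_congr rfl fun k _ => ?_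
    rw [map_smul, weightedShift_pow_e, smul_smul]
  · refine Finset.sum_congr rfl fun l hl => ?_
    rw [map_sum]
    refine Finset.sum_congr rfl fun k hk => ?_
    rw [Finset.mem_erase] at hl
    rw [Finset.mem_range] at hk
    rw [map_smul]
    split_ifs with h
    · have h1 := weightedShift_pow_e he hw (t j) (t l - t j + k)
      rw [show t j + (t l - t j + k) = t l + k by omega] at h1
      rw [h1, smul_smul]
    · have h1 := hsep j hj l hl.2 hl.1.symm
      rw [le_abs] at h1
      rw [weightedShift_pow_e_of_lt he hw (show t l + k < t j by omega), smul_zero]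

end FrechetSequenceAlgebra

/-! ### Density -/

/-- Finitely many conditions, each true below some positive threshold, have a common threshold. -/
theorem exists_pos_forall_mem_finset {ι : Type*} (s : Finset ι) (P : ι → ℝ → Prop)
    (hmono : ∀ i x y, x ≤ y → P i y → P i x) (h : ∀ i ∈ s, ∃ δ : ℝ, 0 < δ ∧ P i δ) :
    ∃ δ : ℝ, 0 < δ ∧ ∀ i ∈ s, P i δ := by
  classical
  induction s using Finset.induction_on with
  | empty => exact ⟨1, one_pos, by simp⟩
  | insert i s hi ih =>
    obtain ⟨δ, hδ, h1⟩ := ih fun j hj => h j (Finset.mem_insert_of_mem hj)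
    obtain ⟨δ', hδ', h2⟩ := h i (Finset.mem_insert_self i s)
    refine ⟨min δ δ', lt_min hδ hδ', fun j hj => ?_⟩
    rcases Finset.mem_insert.1 hj with rfl | hj
    · exact hmono _ _ _ (min_le_right _ _) h2
    · exact hmono _ _ _ (min_le_left _ _) (h1 j hj)

/-- The root `z` is compared with the vector `1 / W ^ (1 / (m + 1))` of the criterion. -/
theorem norm_root_le {m : ℕ} {z : ℂ} {B W : ℝ} (hB : 1 ≤ B) (hW : 0 < W)
    (h : ‖z ^ (m + 1)‖ ≤ B / W) : ‖z‖ ≤ B * (1 / W ^ (1 / ((m + 1 : ℕ) : ℝ))) := by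
  have hr : (W ^ (1 / ((m + 1 : ℕ) : ℝ))) ^ (m + 1) = W := by
    rw [one_div]
    exact Real.rpow_inv_natCast_pow hW.le (Nat.succ_ne_zero m)
  refine le_of_pow_le_pow_left₀ (Nat.succ_ne_zero m) (by positivity) ?_
  rw [← norm_pow, mul_pow, div_pow, hr, one_pow, mul_one_div]
  refine h.trans ?_
  gcongr
  exact le_self_pow₀ hB (Nat.succ_ne_zero m)

namespace FrechetSequenceAlgebra

variable {X : FrechetSequenceAlgebra} (he : ∀ n, Pi.single n (1 : ℂ) ∈ X.toSubalgebra)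

/-- The times of the blocks, preceded by a block at the origin. -/
def originTime {ι : Type*} (t : ι → ℕ) (o : Option ι) : ℕ := o.elim 0 t

/-- After `t j` steps, the distance from the orbit of a block vector to the target `v` is controlled
by the error `e₁` on the block `j` and by the remains of the later blocks, summed over the gaps. -/
theorem IsFNorm.orbit_sub_le {ρ : X → ℝ} (hρ : X.IsFNorm ρ) {w : ℕ → ℝ} (hw : Admissible X w)
    {ι : Type*} [DecidableEq ι] {J : Finset ι} {t : ι → ℕ} {L : ℕ}
    (hsep : ∀ j ∈ Finset.insertNone J, ∀ l ∈ Finset.insertNone J, j ≠ l →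
      (L : ℤ) ≤ |(originTime t j : ℤ) - originTime t l|)
    (y : Option ι → ℕ → ℂ) (v : ℕ → ℂ) {j : ι} (hj : j ∈ J) {e₁ D ε β : ℝ} (hD : 0 ≤ D)
    (h1 : ∀ k < L, ρ ((y (some j) k * ((weightProd w (t j + k) / weightProd w k : ℝ) : ℂ) - v k) •
      e he k) ≤ e₁)
    (h2 : ∀ l ∈ J, t j < t l → ∀ k < L,
      ρ ((y (some l) k * ((weightProd w (t l + k) / weightProd w (t l - t j + k) : ℝ) : ℂ)) •
          e he (t l - t j + k)) ≤ D * (1 / |(t j : ℝ) - t l| ^ β))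
    (h3 : ∑ l ∈ J.erase j, 1 / |(t j : ℝ) - t l| ^ β ≤ ε) :
    ρ ((weightedShift hw ^ t j) (blockSum he (Finset.insertNone J) (originTime t) L y) -
      ∑ k ∈ Finset.range L, v k • e he k) ≤ L * e₁ + L * D * ε := by
  have hj' : some j ∈ Finset.insertNone J := Finset.some_mem_insertNone.2 hj
  have herase : (Finset.insertNone J).erase (some j) = Finset.insertNone (J.erase j) := by
    ext o
    cases o <;> simp
  have h4 := weightedShift_pow_blockSum he hw hsep y hj'
  simp only [originTime, Option.elim_some] at h4 hsep ⊢
  rw [h4, herase, Finset.sum_insertNone, add_sub_right_comm, ← Finset.sum_sub_distrib]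
  simp only [Option.elim_none, Option.elim_some, not_lt_zero, if_false, Finset.sum_const_zero,
    zero_add, ← sub_smul]
  refine (hρ.add_le _ _).trans (add_le_add ?_ ?_)
  · refine (hρ.sum_le _ _).trans ?_
    calc _ ≤ ∑ _k ∈ Finset.range L, e₁ :=
          Finset.sum_le_sum fun k hk => h1 k (Finset.mem_range.1 hk)
      _ = L * e₁ := by simp
  · refine (hρ.sum_le _ _).trans ?_
    calc _ ≤ ∑ l ∈ J.erase j, L * D * (1 / |(t j : ℝ) - t l| ^ β) := by
          refine Finset.sum_le_sum fun l hl => (hρ.sum_le _ _).trans ?_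
          calc _ ≤ ∑ _k ∈ Finset.range L, D * (1 / |(t j : ℝ) - t l| ^ β) := by
                refine Finset.sum_le_sum fun k hk => ?_
                by_cases h : t j < t l
                · exact (congrArg ρ (if_pos h)).le.trans
                    (h2 l (Finset.mem_of_mem_erase hl) h k (Finset.mem_range.1 hk))
                · refine ((congrArg ρ (if_neg h)).trans hρ.map_zero).le.trans ?_
                  positivity
            _ = _ := by simp [mul_assoc]
      _ = L * D * ∑ l ∈ J.erase j, 1 / |(t j : ℝ) - t l| ^ β := by rw [Finset.mul_sum]
      _ ≤ L * D * ε := by gcongr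

theorem blockSum_insertNone_sub {ι : Type*} (J : Finset ι) (t : ι → ℕ) (L : ℕ)
    (y : Option ι → ℕ → ℂ) :
    blockSum he (Finset.insertNone J) (originTime t) L y -
      ∑ k ∈ Finset.range L, y none k • e he k = blockSum he J t L fun j => y (some j) := by
  unfold blockSum
  rw [Finset.sum_insertNone]
  simp [originTime]

/-- The density part of the Baire argument. Near a finitely supported `x` there is a vector `u`, equal
to `x` followed by one block for each cell of a covering schedule, such that for every parameter `l`
in the small cube and every polynomial with bounded coefficients and lowest term `z ^ (m + 1)`,
the time attached to the cell of `l` brings the polynomial in `u` into `V`. -/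
theorem dense_setOf_orbit_hits
    (hdense : Dense (Submodule.span ℂ (Set.range (e he)) : Set X))
    {ρ : X → ℝ} (hρ : X.IsFNorm ρ) {d : ℕ} (hd : 1 ≤ d)
    {α : ℝ} (hα : 0 < α) (hαd : α < 1 / (d : ℝ))
    {I : Set ℝ} {w : I → ℕ → ℝ} (hw : ∀ a, Admissible X (w a))
    (hwcont : ∀ n, 1 ≤ n → Continuous (fun a => w a n)) (m : ℕ)
    {I₀ : Set I} (hI₀ : IsCompact I₀)
    {C₁ C₂ β : ℝ} {F : ℕ → ℝ} {N₀ : ℕ} {M₀ : ℝ} (hC₁ : 0 < C₁) (hC₂ : 0 < C₂) (hβ : α * d < β)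
    (hM₀ : 0 < M₀) (hF : ∀ n, 1 ≤ n → 0 < F n ∧ F n ≤ C₁ * (n : ℝ) ^ α)
    (hlip : ∀ n, N₀ ≤ n → ∀ a ∈ I₀, ∀ b ∈ I₀,
      |∑ i ∈ Finset.Icc 1 n, Real.log (w a i) - ∑ i ∈ Finset.Icc 1 n, Real.log (w b i)|
        ≤ F n * |(a : ℝ) - b|)
    (hinf : ∀ R : ℝ, ∃ k₀ : ℕ, ∀ k, k₀ ≤ k → ∀ a ∈ I₀, R ≤ weightProd (w a) k)
    (hexp : ∀ n k, N₀ ≤ n → N₀ ≤ k → ∀ a ∈ I₀,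
      ρ (((Real.exp (C₂ * (F (n + k) / ((n : ℝ) + k) ^ α) * (k : ℝ) ^ α)
        / weightProd (w a) k : ℝ) : ℂ) • e he k) ≤ M₀ / (k : ℝ) ^ β)
    (hroot : ∀ k, N₀ ≤ k → ∀ a ∈ I₀,
      ρ (((1 / (weightProd (w a) k) ^ (1 / ((m + 1 : ℕ) : ℝ)) : ℝ) : ℂ) • e he k)
        ≤ M₀ / (k : ℝ) ^ β) :
    ∃ η : ℝ, 0 < η ∧ ∀ (a : Fin d → ℝ) (M : ℕ) (K : ℝ), 0 < K → ∀ V : Set (Fin d → X),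
      IsOpen V → V.Nonempty →
      Dense {u : Fin d → X | ∀ (c : Fin M → ℂ) (l : Fin d → I), (∀ q, ‖c q‖ ≤ K) →
        (∀ i, l i ∈ I₀ ∧ (l i : ℝ) ∈ Set.Ico (a i) (a i + η)) →
        ∃ n : ℕ, 1 ≤ n ∧ (productShift hw l)^[n] (fun i => lowPolyVal m c (u i)) ∈ V} := by
  classical
  have hβ0 : 0 < β := lt_of_le_of_lt (by positivity) hβ
  obtain ⟨η, hη, hsched⟩ := exists_covering_schedule (C := C₂ / 3 ^ α) hd hα hαd hβ (by positivity)
  refine ⟨η, hη, fun a M K hK V hV hVne => ?_⟩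
  rw [dense_iff_inter_open]
  intro U hU hUne
  by_cases hκ : ∃ l : Fin d → I, ∀ i, l i ∈ I₀ ∧ (l i : ℝ) ∈ Set.Ico (a i) (a i + η)
  swap
  · obtain ⟨u, hu⟩ := hUne
    exact ⟨u, hu, fun c l _ hl => (hκ ⟨l, hl⟩).elim⟩
  obtain ⟨v, Lv, hv⟩ := exists_finite_support_mem he hdense hV hVne
  obtain ⟨x, Lx, hx⟩ := exists_finite_support_mem he hdense hU hUne
  set L := max Lv Lx with hL
  obtain ⟨ε₁, hε₁, hballV⟩ := hρ.exists_ball_pi hV (hv L (le_max_left _ _))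
  obtain ⟨ε₂, hε₂, hballU⟩ := hρ.exists_ball_pi hU (hx L (le_max_right _ _))
  set ε := min ε₁ ε₂ with hε
  have hε0 : 0 < ε := lt_min hε₁ hε₂
  have hpos : ∀ a n, 0 < weightProd (w a) n := fun a n => weightProd_pos (hw a).pos n
  have hWcont : ∀ k, Continuous fun a => weightProd (w a) k := fun k =>
    continuous_finsetProd _ fun i hi => hwcont i (Finset.mem_Icc.1 hi).1
  -- `B` bounds `‖v i k‖ * w₁ ⋯ w_k`, and `V₀` bounds `‖v i k‖`.
  obtain ⟨B, hB1, hB⟩ : ∃ B : ℕ, 1 ≤ B ∧ ∀ i, ∀ k < L, ∀ a ∈ I₀,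
      ‖v i k‖ * weightProd (w a) k ≤ B := by
    have hcont : Continuous fun a => ∑ i, ∑ k ∈ Finset.range L, ‖v i k‖ * weightProd (w a) k :=
      continuous_finsetSum _ fun i _ => continuous_finsetSum _ fun k _ =>
        continuous_const.mul (hWcont k)
    obtain ⟨B, hB⟩ := (hI₀.image hcont).bddAbove
    refine ⟨⌈B⌉₊ + 1, by omega, fun i k hk a ha => ?_⟩
    have h1 := hB ⟨a, ha, rfl⟩
    dsimp only at h1
    have h2 : ‖v i k‖ * weightProd (w a) k ≤
        ∑ k ∈ Finset.range L, ‖v i k‖ * weightProd (w a) k :=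
      Finset.single_le_sum (f := fun k => ‖v i k‖ * weightProd (w a) k)
        (fun k _ => mul_nonneg (norm_nonneg _) (hpos a k).le) (Finset.mem_range.2 hk)
    have h3 : ∑ k ∈ Finset.range L, ‖v i k‖ * weightProd (w a) k ≤
        ∑ i, ∑ k ∈ Finset.range L, ‖v i k‖ * weightProd (w a) k :=
      Finset.single_le_sum (f := fun i => ∑ k ∈ Finset.range L, ‖v i k‖ * weightProd (w a) k)
        (fun i _ => Finset.sum_nonneg fun k _ => mul_nonneg (norm_nonneg _) (hpos a k).le)
        (Finset.mem_univ i)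
    push_cast
    linarith [Nat.le_ceil B]
  obtain ⟨V₀, hV₀, hvV⟩ : ∃ V₀ : ℝ, 0 < V₀ ∧ ∀ i, ∀ k < L, ‖v i k‖ ≤ V₀ := by
    refine ⟨∑ i, ∑ k ∈ Finset.range L, ‖v i k‖ + 1,
      add_pos_of_nonneg_of_pos (by positivity) one_pos, fun i k hk => ?_⟩
    have h2 : ‖v i k‖ ≤ ∑ k ∈ Finset.range L, ‖v i k‖ :=
      Finset.single_le_sum (f := fun k => ‖v i k‖) (fun k _ => norm_nonneg _)
        (Finset.mem_range.2 hk)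
    have h3 : ∑ k ∈ Finset.range L, ‖v i k‖ ≤ ∑ i, ∑ k ∈ Finset.range L, ‖v i k‖ :=
      Finset.single_le_sum (f := fun i => ∑ k ∈ Finset.range L, ‖v i k‖)
        (fun i _ => by positivity) (Finset.mem_univ i)
    linarith
  have hB1' : (1 : ℝ) ≤ B := by exact_mod_cast hB1
  have hB0 : (0 : ℝ) < B := by linarith
  -- Coefficients at distance at most `δ` give vectors at distance at most `ε / 4` in total.
  obtain ⟨δ, hδ0, hδ⟩ := exists_pos_forall_mem_finset (Finset.range L)
    (fun k δ => ∀ c : ℂ, ‖c‖ ≤ δ → ρ (c • e he k) ≤ ε / (4 * (L + 1)))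
    (fun k x y hxy h c hc => h c (hc.trans hxy))
    (fun k _ => hρ.exists_smul_le (e he k) (by positivity))
  -- `τ` bounds the relative errors: the weight ratios and the higher terms of the polynomials.
  obtain ⟨τ, hτ0, hτ1, hτδ⟩ : ∃ τ : ℝ, 0 < τ ∧ τ ≤ 1 ∧ V₀ * (5 * τ) ≤ δ := by
    refine ⟨min 1 (δ / (5 * V₀)), by positivity, min_le_left _ _, ?_⟩
    calc V₀ * (5 * min 1 (δ / (5 * V₀))) ≤ V₀ * (5 * (δ / (5 * V₀))) := by
          gcongr; exact min_le_right _ _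
      _ = δ := by field_simp
  -- The products of few weights are not covered by the Lipschitz condition; uniform continuity on
  -- the compact set `I₀` replaces it.
  obtain ⟨σ, hσ0, hσ⟩ := exists_pos_forall_mem_finset (Finset.range L)
    (fun k σ => ∀ a ∈ I₀, ∀ b ∈ I₀, |(a : ℝ) - b| ≤ σ →
      |Real.log (weightProd (w a) k) - Real.log (weightProd (w b) k)| ≤ τ / 2)
    (fun k x y hxy h a ha b hb hab => h a ha b hb (hab.trans hxy)) (by
      intro k _
      have hc : Continuous fun a => Real.log (weightProd (w a) k) :=
        (hWcont k).log fun a => (hpos a k).ne'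
      obtain ⟨s, hs, h⟩ := Metric.uniformContinuousOn_iff.1
        (hI₀.uniformContinuousOn_of_continuous hc.continuousOn) (τ / 2) (by positivity)
      refine ⟨s / 2, by positivity, fun a ha b hb hab => ?_⟩
      have := h a ha b hb (by rw [Subtype.dist_eq, Real.dist_eq]; linarith)
      rw [Real.dist_eq] at this
      exact this.le)
  obtain ⟨ζ, hζ0, hζ1, hζτ⟩ : ∃ ζ : ℝ, 0 < ζ ∧ ζ ≤ 1 ∧ M * (K * ζ) ≤ τ := by
    refine ⟨min 1 (τ / ((M + 1) * K)), by positivity, min_le_left _ _, ?_⟩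
    calc M * (K * min 1 (τ / ((M + 1) * K))) ≤ (M + 1) * (K * (τ / ((M + 1) * K))) := by
          gcongr
          · linarith
          · exact min_le_right _ _
      _ = τ := by field_simp
  -- Beyond `k₀` the products of weights are so large that the roots are bounded by `ζ`.
  obtain ⟨k₀, hk₀⟩ := hinf (B / ζ ^ (m + 1))
  set D : ℝ := ((2 * B : ℕ) : ℝ) * M₀ with hD
  have hD0 : 0 < D := by positivity
  obtain ⟨ε', hε'0, hε'σ, hε'τ, hε'ε⟩ : ∃ ε' : ℝ, 0 < ε' ∧ ε' ≤ σ ∧ C₁ * 3 ^ α * ε' ≤ τ / 2 ∧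
      L * D * ε' ≤ ε / 4 := by
    refine ⟨min σ (min (τ / 2 / (C₁ * 3 ^ α)) (ε / 4 / (L * D + 1))), by positivity,
      min_le_left _ _, ?_, ?_⟩
    · rw [← le_div_iff₀' (by positivity)]
      exact (min_le_right _ _).trans (min_le_left _ _)
    · calc L * D * min σ (min (τ / 2 / (C₁ * 3 ^ α)) (ε / 4 / (L * D + 1)))
          ≤ (L * D + 1) * (ε / 4 / (L * D + 1)) := by
            gcongr
            · linarith
            · exact (min_le_right _ _).trans (min_le_right _ _)
        _ = ε / 4 := by field_simp
  -- The parameters of the piece, and the schedule of the times at which they are treated.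
  let κ : Type := {l : Fin d → I // ∀ i, l i ∈ I₀ ∧ (l i : ℝ) ∈ Set.Ico (a i) (a i + η)}
  have : Nonempty κ := hκ.elim fun l hl => ⟨⟨l, hl⟩⟩
  obtain ⟨N, hN, hN0, J, cell, rep, t, hcell, htN, hsep, hgap, hhold, hcard⟩ :=
    hsched (fun (l : κ) i => (l.1 i : ℝ)) a (fun l i => (l.2 i).2) ε' hε'0 (L + N₀ + k₀ + 1)
  have hN1 : (1 : ℝ) ≤ N := by exact_mod_cast hN0
  have hLN : (L : ℝ) ≤ N := by exact_mod_cast (show L ≤ N by omega)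
  -- The roots `z i j k` are chosen so that the lowest power is carried exactly to `v i k` at time
  -- `t j` for the parameter `rep j`.
  have hz : ∀ i j k, ∃ z : ℂ, z ^ (m + 1) = v i k *
      ((weightProd (w ((rep j).1 i)) k / weightProd (w ((rep j).1 i)) (t j + k) : ℝ) : ℂ) :=
    fun i j k => IsAlgClosed.exists_pow_nat_eq _ (Nat.succ_pos m)
  choose z hz using hz
  have hzpow : ∀ i, ∀ k < L, ∀ j, ‖z i j k ^ (m + 1)‖ ≤
      B / weightProd (w ((rep j).1 i)) (t j + k) := by
    intro i k hk j
    rw [hz, norm_mul, Complex.norm_real, Real.norm_eq_abs,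
      abs_of_pos (div_pos (hpos _ _) (hpos _ _)), ← mul_div_assoc]
    have := hpos ((rep j).1 i) (t j + k)
    gcongr
    exact hB i k hk _ ((rep j).2 i).1
  have hzζ : ∀ i, ∀ k < L, ∀ j ∈ J, ‖z i j k‖ ≤ ζ := by
    intro i k hk j hj
    refine le_of_pow_le_pow_left₀ (Nat.succ_ne_zero m) hζ0.le ?_
    rw [← norm_pow]
    refine (hzpow i k hk j).trans ?_
    have h1 := hk₀ (t j + k) (by have := (htN j hj).1; omega) _ ((rep j).2 i).1
    rw [div_le_iff₀ (by positivity)] at h1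
    rw [div_le_iff₀ (hpos _ _), mul_comm]
    exact h1
  -- The block of index `none`, at time `0`, is `x`.
  set Z : Fin d → Option (Fin d → ℕ) → ℕ → ℂ := fun i o k => o.elim (x i k) fun j => z i j k
    with hZ
  set u : Fin d → X := fun i => blockSum he (Finset.insertNone J) (originTime t) L (Z i) with hu
  have hsep' : ∀ j ∈ Finset.insertNone J, ∀ l ∈ Finset.insertNone J, j ≠ l →
      (L : ℤ) ≤ |(originTime t j : ℤ) - originTime t l| := by
    intro j hj l hl hjl
    cases j with
    | none =>
      cases l with
      | none => exact absurd rfl hjl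
      | some l =>
        have := (htN l (Finset.some_mem_insertNone.1 hl)).1
        simp only [originTime, Option.elim_none, Option.elim_some]
        rw [le_abs]
        omega
    | some j =>
      cases l with
      | none =>
        have := (htN j (Finset.some_mem_insertNone.1 hj)).1
        simp only [originTime, Option.elim_none, Option.elim_some]
        rw [le_abs]
        omega
      | some l =>
        have := hsep j (Finset.some_mem_insertNone.1 hj) l (Finset.some_mem_insertNone.1 hl)
          fun h => hjl (by rw [h])
        simp only [originTime, Option.elim_some]
        push_cast at this
        linarith
  refine ⟨u, hballU u fun i => ?_, fun c l hc hl => ?_⟩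
  · have h1 := blockSum_insertNone_sub he J t L (Z i)
    simp only [hZ, Option.elim_none, Option.elim_some] at h1
    simp only [hu, hZ]
    rw [h1]
    have h2 : ρ (blockSum he J t L fun j k => z i j k) ≤ (J.card : ℝ) / (N : ℝ) ^ β * (L * D) := by
      refine (hρ.sum_le _ _).trans ?_
      calc _ ≤ ∑ _j ∈ J, (L : ℝ) * (D / (N : ℝ) ^ β) := by
            refine Finset.sum_le_sum fun j hj => (hρ.sum_le _ _).trans ?_
            calc _ ≤ ∑ _k ∈ Finset.range L, D / (N : ℝ) ^ β := by
                  refine Finset.sum_le_sum fun k hk => ?_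
                  have hjN := (htN j hj).1
                  have h3 := norm_root_le hB1' (hpos _ _) (hzpow i k (Finset.mem_range.1 hk) j)
                  have h4 := hρ.smul_le_natCast_mul (n := B) (a := z i j k)
                    (b := ((1 / (weightProd (w ((rep j).1 i)) (t j + k)) ^
                      (1 / ((m + 1 : ℕ) : ℝ)) : ℝ) : ℂ)) (by
                    rw [Complex.norm_real, Real.norm_eq_abs, abs_of_pos
                      (one_div_pos.2 (Real.rpow_pos_of_pos (hpos _ _) _))]
                    exact h3) (e he (t j + k))
                  refine h4.trans ?_
                  have h5 := hroot (t j + k) (by omega) _ ((rep j).2 i).1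
                  have h6 : (N : ℝ) ^ β ≤ ((t j + k : ℕ) : ℝ) ^ β := by
                    gcongr
                    omega
                  calc (B : ℝ) * _ ≤ B * (M₀ / ((t j + k : ℕ) : ℝ) ^ β) := by gcongr
                    _ ≤ B * (M₀ / (N : ℝ) ^ β) := by gcongr
                    _ ≤ D / (N : ℝ) ^ β := by
                      rw [hD, mul_div_assoc]
                      push_cast
                      gcongr
                      linarith
              _ = _ := by simp
        _ = _ := by rw [Finset.sum_const, nsmul_eq_mul]; ring
    have h3 : (J.card : ℝ) / (N : ℝ) ^ β * (L * D) ≤ ε / 4 := by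
      calc _ ≤ ε' * (L * D) := by gcongr
        _ = L * D * ε' := by ring
        _ ≤ _ := hε'ε
    linarith [min_le_right ε₁ ε₂]
  · set k' : κ := ⟨l, hl⟩ with hk'
    obtain ⟨j, hj⟩ : ∃ j, j = cell k' := ⟨_, rfl⟩
    obtain ⟨hjJ, hjclose⟩ := hcell k'
    rw [← hj] at hjJ hjclose
    refine ⟨t j, hN0.trans_le (htN j hjJ).1, hballV _ fun i => ?_⟩
    rw [iterate_productShift_apply]
    simp only [hu]
    rw [lowPolyVal_blockSum he hsep']
    have hlow : ∀ l ∈ J, ∀ k < L, ∃ h : ℂ,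
        lowPoly m c (z i l k) = z i l k ^ (m + 1) * (1 + h) ∧ ‖h‖ ≤ τ := by
      intro l hl k hk
      have h1 := hzζ i k hk l hl
      obtain ⟨h, h2, h3⟩ := exists_lowPoly_eq (m := m) hc hK.le (h1.trans hζ1)
      refine ⟨h, h2, h3.trans (le_trans ?_ hζτ)⟩
      gcongr
    have h3N : ∀ l ∈ J, ∀ k < L, ((t l + k : ℕ) : ℝ) ≤ 3 * N := by
      intro l hl k hk
      have := (htN l hl).2
      exact_mod_cast (show t l + k ≤ 3 * N by omega)
    have key := hρ.orbit_sub_le he (hw (l i)) hsep' (fun o k => lowPoly m c (Z i o k)) (v i) hjJ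
      (e₁ := ε / (4 * (L + 1))) (D := D) (ε := ε') (β := β) hD0.le ?_ ?_ (hgap j hjJ)
    · refine key.trans_lt ?_
      have h1 : L * (ε / (4 * (L + 1))) ≤ ε / 4 := by
        rw [← mul_div_assoc, div_le_div_iff₀ (by positivity) (by norm_num)]
        nlinarith
      linarith [min_le_left ε₁ ε₂]
    · intro k hk
      refine hδ k (Finset.mem_range.2 hk) _ ?_
      simp only [hZ, Option.elim_some]
      obtain ⟨h, h1, h2⟩ := hlow j hjJ k hk
      rw [h1, hz]
      have hclose := hjclose i
      have hNα : 1 ≤ (N : ℝ) ^ α := Real.one_le_rpow hN1 hα.le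
      refine (norm_mul_weight_ratio_sub_le (hw _).pos (hw _).pos hτ1 ?_ ?_ h2).trans
        (le_trans ?_ hτδ)
      · have h4 := htN j hjJ
        have h5 := hlip (t j + k) (by omega) (l i) (hl i).1 _ ((rep j).2 i).1
        rw [← log_weightProd (hw _).pos, ← log_weightProd (hw _).pos] at h5
        refine h5.trans (le_trans ?_ hε'τ)
        calc F (t j + k) * |(l i : ℝ) - (rep j).1 i|
            ≤ C₁ * ((t j + k : ℕ) : ℝ) ^ α * |(l i : ℝ) - (rep j).1 i| := by
              gcongr
              exact (hF _ (by omega)).2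
          _ ≤ C₁ * (3 * N) ^ α * |(l i : ℝ) - (rep j).1 i| := by
              gcongr
              exact h3N j hjJ k hk
          _ = C₁ * 3 ^ α * ((N : ℝ) ^ α * |(l i : ℝ) - (rep j).1 i|) := by
              rw [Real.mul_rpow (by norm_num) (by positivity)]; ring
          _ ≤ C₁ * 3 ^ α * ε' := by gcongr
      · refine hσ k (Finset.mem_range.2 hk) _ (hl i).1 _ ((rep j).2 i).1 (le_trans ?_ hε'σ)
        refine le_trans ?_ hclose
        exact le_mul_of_one_le_left (abs_nonneg _) hNα
      · gcongr
        exact hvV i k hk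
    · intro l' hl' hlt k hk
      have hne : l' ≠ j := by rintro rfl; exact lt_irrefl _ hlt
      have hs := hsep j hjJ l' hl' hne.symm
      have ht1 := htN j hjJ
      have ht2 := htN l' hl'
      have hgapeq : |(t j : ℝ) - t l'| = ((t l' - t j : ℕ) : ℝ) := by
        rw [Nat.cast_sub hlt.le, abs_sub_comm, abs_of_nonneg]
        exact sub_nonneg.2 (by exact_mod_cast hlt.le)
      have hgapN : N₀ ≤ t l' - t j := by
        rw [le_abs] at hs
        omega
      have hgap0 : (0 : ℝ) < ((t l' - t j : ℕ) : ℝ) := by exact_mod_cast Nat.sub_pos_of_lt hlt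
      obtain ⟨h, h1, h2⟩ := hlow l' hl' k hk
      have hx' := hhold k' l' hl' (hj ▸ hne) i
      rw [← hj, hgapeq] at hx'
      set n' := t l' - t j + k with hn'
      have hsum : t j + n' = t l' + k := by omega
      have hsum' : (t j : ℝ) + n' = ((t l' + k : ℕ) : ℝ) := by exact_mod_cast hsum
      have hgn : ((t l' - t j : ℕ) : ℝ) ≤ n' := by exact_mod_cast Nat.le_add_right _ _
      have hE := exp_mul_le_exp_criterion (f := F (t l' + k)) (n₁ := t j) (k := n')
        (hF _ (by omega)).1 hC₂ hα hgap0 hgn (by linarith : (0 : ℝ) < N)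
        (by rw [hsum']; exact h3N l' hl' k hk) hx'
      have hW := weightProd_le_exp_mul (hw (l i)).pos (hw ((rep l').1 i)).pos
        (hlip (t l' + k) (by omega) (l i) (hl i).1 _ ((rep l').2 i).1)
      have hcr := hexp (t j) n' (by omega) (by omega) (l i) (hl i).1
      rw [hsum] at hcr
      simp only [hZ, Option.elim_some]
      refine (hρ.smul_le_natCast_mul (n := 2 * B) ?_ (e he n')).trans
        ((mul_le_mul_of_nonneg_left hcr (Nat.cast_nonneg _)).trans ?_)
      · have hp1 := hpos (l i) (t l' + k)
        have hp2 := hpos (l i) n'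
        have hp3 := hpos ((rep l').1 i) (t l' + k)
        rw [h1, norm_mul, norm_mul, Complex.norm_real, Complex.norm_real, Real.norm_eq_abs,
          Real.norm_eq_abs, abs_of_pos (div_pos hp1 hp2), abs_of_pos (div_pos (Real.exp_pos _) hp2)]
        have h5 : ‖1 + h‖ ≤ 2 := by
          refine (norm_add_le _ _).trans ?_
          rw [norm_one]
          linarith
        calc ‖z i l' k ^ (m + 1)‖ * ‖1 + h‖ *
              (weightProd (w (l i)) (t l' + k) / weightProd (w (l i)) n')
            ≤ B / weightProd (w ((rep l').1 i)) (t l' + k) * 2 *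
              ((Real.exp (F (t l' + k) * |(l i : ℝ) - (rep l').1 i|) *
                weightProd (w ((rep l').1 i)) (t l' + k)) / weightProd (w (l i)) n') := by
              gcongr
              exact hzpow i k hk l'
          _ = 2 * B * (Real.exp (F (t l' + k) * |(l i : ℝ) - (rep l').1 i|) /
                weightProd (w (l i)) n') := by field_simp
          _ ≤ 2 * B * (Real.exp (C₂ * (F (t l' + k) / ((t j : ℝ) + n') ^ α) * (n' : ℝ) ^ α) /
                weightProd (w (l i)) n') := by gcongr
          _ = _ := by push_cast; ring
      · rw [hD, mul_assoc, mul_one_div, hgapeq]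
        gcongr

end FrechetSequenceAlgebra

/-! ### The algebra generated by a generic vector -/

/-- A nonzero polynomial without constant term is a multiple of some `lowPoly m c`. -/
theorem Polynomial.exists_eval_eq_mul_lowPoly {P : Polynomial ℂ} (hP : P ≠ 0) (h0 : P.eval 0 = 0) :
    ∃ (a : ℂ) (m M : ℕ) (c : Fin M → ℂ), a ≠ 0 ∧ (∀ q, ‖c q‖ ≤ M + 1) ∧
      ∀ x, P.eval x = a * lowPoly m c x := by
  have hne : P.natTrailingDegree ≠ 0 := by
    rw [Ne, Polynomial.natTrailingDegree_eq_zero]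
    push Not
    exact ⟨hP, by rwa [Polynomial.coeff_zero_eq_eval_zero]⟩
  obtain ⟨m, hm⟩ := Nat.exists_eq_succ_of_ne_zero hne
  have ha : P.coeff (m + 1) ≠ 0 := by
    have := Polynomial.coeff_natTrailingDegree_ne_zero.2 hP
    rwa [hm] at this
  obtain ⟨B, hB⟩ := exists_nat_ge (∑ i ∈ P.support, ‖P.coeff i / P.coeff (m + 1)‖)
  refine ⟨P.coeff (m + 1), m, max P.natDegree B,
    fun q => P.coeff (m + 2 + q) / P.coeff (m + 1), ha, fun q => ?_, fun x => ?_⟩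
  · have h1 : (B : ℝ) ≤ (max P.natDegree B : ℕ) := by exact_mod_cast le_max_right _ _
    by_cases h : m + 2 + (q : ℕ) ∈ P.support
    · have := Finset.single_le_sum (f := fun i => ‖P.coeff i / P.coeff (m + 1)‖)
        (fun i _ => norm_nonneg _) h
      exact this.trans (by linarith)
    · change ‖P.coeff (m + 2 + q) / P.coeff (m + 1)‖ ≤ _
      rw [Polynomial.notMem_support_iff.1 h, zero_div, norm_zero]
      positivity
  · rw [Polynomial.eval_eq_sum_range' (n := m + 1 + (max P.natDegree B + 1))
      (by have := le_max_left P.natDegree B; omega), Finset.sum_range_add, Finset.sum_eq_zero,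
      zero_add, Finset.sum_range_succ', lowPoly, mul_add, add_comm, Finset.mul_sum,
      Finset.sum_range]
    · congr 1
      refine Finset.sum_congr rfl fun q _ => ?_
      rw [← mul_assoc, mul_div_cancel₀ _ ha, show m + 1 + ((q : ℕ) + 1) = m + 2 + q by ring]
    · intro i hi
      rw [Polynomial.coeff_eq_zero_of_lt_natTrailingDegree
        (by rw [hm]; exact Finset.mem_range.1 hi), zero_mul]

namespace FrechetSequenceAlgebra

variable {X : FrechetSequenceAlgebra}

/-- The polynomials without constant term in `u`, computed coordinatewise. -/
def polynomialAlgebra {ι : Type*} (u : ι → X) : NonUnitalSubalgebra ℂ (ι → X) where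
  carrier := {x | ∃ P : Polynomial ℂ, P.eval 0 = 0 ∧
    ∀ i n, toSeq (x i) n = P.eval (toSeq (u i) n)}
  add_mem' := by
    rintro x y ⟨P, hP, hx⟩ ⟨Q, hQ, hy⟩
    refine ⟨P + Q, by simp [hP, hQ], fun i n => ?_⟩
    rw [Polynomial.eval_add, ← hx, ← hy]
    rfl
  zero_mem' := ⟨0, by simp, fun i n => by rw [Polynomial.eval_zero]; rfl⟩
  mul_mem' := by
    rintro x y ⟨P, hP, hx⟩ ⟨Q, hQ, hy⟩
    refine ⟨P * Q, by simp [hP], fun i n => ?_⟩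
    rw [Polynomial.eval_mul, ← hx, ← hy]
    rfl
  smul_mem' := by
    rintro c x ⟨P, hP, hx⟩
    refine ⟨Polynomial.C c * P, by simp [hP], fun i n => ?_⟩
    rw [Polynomial.eval_mul, Polynomial.eval_C, ← hx]
    rfl

theorem mem_polynomialAlgebra_self {ι : Type*} (u : ι → X) : u ∈ polynomialAlgebra u :=
  ⟨Polynomial.X, by simp, fun i n => by simp⟩

/-- Up to a scalar, every nonzero element of the algebra generated by `u` has the normalized form used
in the Baire argument. -/
theorem exists_eq_smul_lowPolyVal {ι : Type*} {u x : ι → X} (hx : x ∈ polynomialAlgebra u)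
    (hne : x ≠ 0) : ∃ (a : ℂ) (m M : ℕ) (c : Fin M → ℂ), a ≠ 0 ∧ (∀ q, ‖c q‖ ≤ M + 1) ∧
      x = a • fun i => lowPolyVal m c (u i) := by
  obtain ⟨P, hP0, hP⟩ := hx
  have hPne : P ≠ 0 := by
    rintro rfl
    refine hne (funext fun i => toSeq_injective (funext fun n => ?_))
    rw [hP, Polynomial.eval_zero]
    rfl
  obtain ⟨a, m, M, c, ha, hc, h⟩ := Polynomial.exists_eval_eq_mul_lowPoly hPne hP0
  refine ⟨a, m, M, c, ha, hc, funext fun i => toSeq_injective (funext fun n => ?_)⟩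
  rw [hP, h, ← toSeq_lowPolyVal]
  rfl

theorem continuous_iterate_productShift {I : Set ℝ} {w : I → ℕ → ℝ}
    (hw : ∀ a, Admissible X (w a)) {d : ℕ}
    (hT : Continuous (fun z : (Fin d → I) × (Fin d → X) => productShift hw z.1 z.2)) (n : ℕ) :
    Continuous (fun z : (Fin d → I) × (Fin d → X) => (productShift hw z.1)^[n] z.2) := by
  induction n with
  | zero => exact continuous_snd
  | succ n ih =>
    simp only [Function.iterate_succ_apply']
    exact hT.comp (continuous_fst.prodMk ih)

/-- The openness part of the Baire argument, a consequence of the compactness of `Q` and of joint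
continuity. -/
theorem isOpen_setOf_orbit_hits {I : Set ℝ} {w : I → ℕ → ℝ}
    (hw : ∀ a, Admissible X (w a)) {d : ℕ}
    (hT : Continuous (fun z : (Fin d → I) × (Fin d → X) => productShift hw z.1 z.2)) (m : ℕ)
    {M : ℕ} {Q : Set ((Fin M → ℂ) × (Fin d → I))} (hQ : IsCompact Q) {V : Set (Fin d → X)}
    (hV : IsOpen V) :
    IsOpen {u : Fin d → X | ∀ z ∈ Q, ∃ n : ℕ, 1 ≤ n ∧
      (productShift hw z.2)^[n] (fun i => lowPolyVal m z.1 (u i)) ∈ V} := by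
  rw [isOpen_iff_eventually]
  intro u hu
  refine hQ.eventually_forall_of_forall_eventually fun z hz => ?_
  obtain ⟨n, hn, hmem⟩ := hu z hz
  have hpoly : Continuous fun p : (Fin d → X) × ((Fin M → ℂ) × (Fin d → I)) =>
      (p.2.2, fun i => lowPolyVal m p.2.1 (p.1 i)) := by
    refine continuous_snd.snd.prodMk (continuous_pi fun i => ?_)
    have h1 : Continuous fun p : (Fin d → X) × ((Fin M → ℂ) × (Fin d → I)) =>
      (p.2.1, p.1 i) := continuous_snd.fst.prodMk ((continuous_apply i).comp continuous_fst)
    exact (continuous_lowPolyVal m M).comp h1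
  have hopen := hV.preimage ((continuous_iterate_productShift hw hT n).comp hpoly)
  have hmem' := hopen.mem_nhds (x := (u, z)) hmem
  exact mem_of_superset hmem' fun p hp => ⟨n, hn, hp⟩

end FrechetSequenceAlgebra

open FrechetSequenceAlgebra in
theorem mainTheorem2
    (X : FrechetSequenceAlgebra)
    (he : ∀ n, Pi.single n (1 : ℂ) ∈ X.toSubalgebra)
    (hdense : Dense (Submodule.span ℂ (Set.range (FrechetSequenceAlgebra.e he)) : Set X))
    (ρ : X → ℝ) (hρ : X.IsFNorm ρ)
    (d : ℕ) (hd : 1 ≤ d)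
    (α : ℝ) (hα : 0 < α) (hαd : α < 1 / (d : ℝ))
    (I : Set ℝ) (hI : I ⊆ Set.Ioi 0) (hIσ : IsSigmaCompact I)
    (w : I → ℕ → ℝ) (hw : ∀ a, Admissible X (w a))
    (hwcont : ∀ n, 1 ≤ n → Continuous (fun a => w a n))
    (hTcont : Continuous (fun z : (Fin d → I) × (Fin d → X) => productShift hw z.1 z.2))
    (hcrit : ∀ m' : ℕ, 1 ≤ m' → ∀ I₀ : Set I, IsCompact I₀ →
      ∃ (C₁ C₂ β : ℝ) (F : ℕ → ℝ) (N₀ : ℕ) (M₀ : ℝ),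
        0 < C₁ ∧ 0 < C₂ ∧ α * d < β ∧ 0 < N₀ ∧ 0 < M₀ ∧
        (∀ n, 1 ≤ n → 0 < F n ∧ F n ≤ C₁ * (n : ℝ) ^ α) ∧
        (∀ n, N₀ ≤ n → ∀ a ∈ I₀, ∀ b ∈ I₀,
          |∑ i ∈ Finset.Icc 1 n, Real.log (w a i) - ∑ i ∈ Finset.Icc 1 n, Real.log (w b i)|
            ≤ F n * |(a : ℝ) - b|) ∧
        (∀ R : ℝ, ∃ k₀ : ℕ, ∀ k, k₀ ≤ k → ∀ a ∈ I₀, R ≤ weightProd (w a) k) ∧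
        (∀ n k, N₀ ≤ n → N₀ ≤ k → ∀ a ∈ I₀,
          ρ (((Real.exp (C₂ * (F (n + k) / ((n : ℝ) + k) ^ α) * (k : ℝ) ^ α)
                / weightProd (w a) k : ℝ) : ℂ) • FrechetSequenceAlgebra.e he k)
            ≤ M₀ / (k : ℝ) ^ β) ∧
        (∀ k, N₀ ≤ k → ∀ a ∈ I₀,
          ρ (((1 / (weightProd (w a) k) ^ (1 / (m' : ℝ)) : ℝ) : ℂ) • FrechetSequenceAlgebra.e he k)
            ≤ M₀ / (k : ℝ) ^ β)) :
    ∃ A : NonUnitalSubalgebra ℂ (Fin d → X),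
      IsCommonHypercyclicAlgebra (fun l : Fin d → I => productShift hw l) A := by
  classical
  have hbaire : BaireSpace (Fin d → X) := baireSpace_pi (Fin d)
  have hsecond : SecondCountableTopology X := secondCountableTopology he hdense
  have hT1 : T1Space X := t1Space
  have hσ : SigmaCompactSpace I := isSigmaCompact_iff_sigmaCompactSpace.1 hIσ
  have hne : (fun _ => e he 0 : Fin d → X) ≠ 0 := by
    intro h
    have h1 := congrFun (congrArg toSeq (congrFun h ⟨0, hd⟩)) 0
    rw [toSeq_e, Pi.single_eq_same] at h1
    exact one_ne_zero h1
  rcases isEmpty_or_nonempty (Fin d → I) with hΛ | ⟨⟨l₀⟩⟩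
  · exact ⟨⊤, ⟨_, trivial, hne⟩, fun x _ _ l => (hΛ.false l).elim⟩
  have hη : ∀ m n : ℕ, ∃ η : ℝ, 0 < η ∧ ∀ (a : Fin d → ℝ) (M : ℕ) (K : ℝ), 0 < K →
      ∀ V : Set (Fin d → X), IsOpen V → V.Nonempty →
      Dense {u : Fin d → X | ∀ (c : Fin M → ℂ) (l : Fin d → I), (∀ q, ‖c q‖ ≤ K) →
        (∀ i, l i ∈ compactCovering I n ∧ (l i : ℝ) ∈ Set.Ico (a i) (a i + η)) →
        ∃ n : ℕ, 1 ≤ n ∧ (productShift hw l)^[n] (fun i => lowPolyVal m c (u i)) ∈ V} := by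
    intro m n
    obtain ⟨C₁, C₂, β, F, N₀, M₀, hC₁, hC₂, hβ, -, hM₀, hF, hlip, hinf, hexp, hroot⟩ :=
      hcrit (m + 1) (Nat.succ_pos m) _ (isCompact_compactCovering I n)
    exact dense_setOf_orbit_hits he hdense hρ hd hα hαd hw hwcont m
      (isCompact_compactCovering I n) hC₁ hC₂ hβ hM₀ hF hlip hinf hexp hroot
  choose η hη0 hη using hη
  -- Compact pieces of the set of pairs (coefficients, parameters). The boxes have half the side
  -- allowed by the density result, since they have to be closed.
  set Q : (m M n : ℕ) → (Fin d → ℤ) → Set ((Fin M → ℂ) × (Fin d → I)) := fun m M n r =>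
    (Set.univ.pi fun _ => Metric.closedBall 0 (M + 1)) ×ˢ
      (Set.univ.pi fun i => compactCovering I n ∩
        Subtype.val ⁻¹' Set.Icc (r i * (η m n / 2)) (r i * (η m n / 2) + η m n / 2)) with hQdef
  have hQ : ∀ m M n r, IsCompact (Q m M n r) := fun m M n r =>
    (isCompact_univ_pi fun _ => isCompact_closedBall _ _).prod (isCompact_univ_pi fun i =>
      (isCompact_compactCovering I n).inter_right (isClosed_Icc.preimage continuous_subtype_val))
  -- The countably many generic conditions.
  set G : ℕ × ℕ × ℕ × (Fin d → ℤ) × TopologicalSpace.countableBasis (Fin d → X) →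
      Set (Fin d → X) := fun s => {u | ∀ z ∈ Q s.1 s.2.1 s.2.2.1 s.2.2.2.1, ∃ n : ℕ, 1 ≤ n ∧
        (productShift hw z.2)^[n] (fun i => lowPolyVal s.1 z.1 (u i)) ∈ s.2.2.2.2.1} with hG
  have hGopen : ∀ s, IsOpen (G s) := fun s => isOpen_setOf_orbit_hits hw hTcont s.1
    (hQ _ _ _ _) (TopologicalSpace.isOpen_of_mem_countableBasis s.2.2.2.2.2)
  have hGdense : ∀ s, Dense (G s) := by
    rintro ⟨m, M, n, r, V, hV⟩
    refine (hη m n (fun i => r i * (η m n / 2)) M (M + 1) (by positivity) V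
      (TopologicalSpace.isOpen_of_mem_countableBasis hV)
      (TopologicalSpace.nonempty_of_mem_countableBasis hV)).mono ?_
    rintro u hu ⟨c, l⟩ ⟨hc, hl⟩
    refine hu c l (fun q => by simpa using hc q trivial) fun i => ?_
    obtain ⟨h1, h2, h3⟩ := hl i trivial
    exact ⟨h1, h2, by linarith [hη0 m n]⟩
  obtain ⟨u, hu⟩ := (dense_iInter_of_isOpen hGopen hGdense).nonempty
  rw [Set.mem_iInter] at hu
  have hhit : ∀ (m M : ℕ) (c : Fin M → ℂ), (∀ q, ‖c q‖ ≤ M + 1) → ∀ (l : Fin d → I)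
      (V : Set (Fin d → X)), IsOpen V → V.Nonempty → ∃ N : ℕ, 1 ≤ N ∧
        (productShift hw l)^[N] (fun i => lowPolyVal m c (u i)) ∈ V := by
    rintro m M c hc l V hV ⟨y, hy⟩
    obtain ⟨V', hV'mem, -, hV'sub⟩ :=
      (TopologicalSpace.isBasis_countableBasis (Fin d → X)).exists_subset_of_mem_open hy hV
    obtain ⟨n, hn⟩ : ∃ n, ∀ i, l i ∈ compactCovering I n := by
      choose f hf using fun i => exists_mem_compactCovering (l i)
      exact ⟨Finset.univ.sup f, fun i => compactCovering_subset I
        (Finset.le_sup (Finset.mem_univ i)) (hf i)⟩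
    have hη2 : 0 < η m n / 2 := half_pos (hη0 m n)
    obtain ⟨N, hN, hmem⟩ := hu ⟨m, M, n, fun i => ⌊(l i : ℝ) / (η m n / 2)⌋, V', hV'mem⟩ (c, l)
      ⟨fun q _ => by simpa using hc q, fun i _ => ⟨hn i, by
        have h1 := Int.floor_le ((l i : ℝ) / (η m n / 2))
        have h2 := (Int.lt_floor_add_one ((l i : ℝ) / (η m n / 2))).le
        rw [le_div_iff₀ hη2] at h1
        rw [div_le_iff₀ hη2, add_mul, one_mul] at h2
        exact ⟨h1, h2⟩⟩⟩
    exact ⟨N, hN, hV'sub hmem⟩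
  have hsmul : ∀ (l : Fin d → I) (N : ℕ) (a : ℂ) (y : Fin d → X),
      (productShift hw l)^[N] (a • y) = a • (productShift hw l)^[N] y := by
    intro l N a y
    funext i
    rw [Pi.smul_apply, iterate_productShift_apply, iterate_productShift_apply, Pi.smul_apply,
      map_smul]
  refine ⟨polynomialAlgebra u, ⟨u, mem_polynomialAlgebra_self u, ?_⟩, fun x hx hx0 l => ?_⟩
  · -- The orbit of `u` meets the open set of nonzero vectors.
    rintro rfl
    obtain ⟨N, -, hmem⟩ := hhit 0 0 0 (by simp) l₀ {0}ᶜ isOpen_compl_singleton ⟨_, hne⟩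
    apply hmem
    have h1 : (fun i => lowPolyVal 0 (0 : Fin 0 → ℂ) ((0 : Fin d → X) i)) =
        (0 : ℂ) • (0 : Fin d → X) := by
      funext i
      simp [lowPolyVal, powSucc]
    rw [h1, hsmul, zero_smul]
    rfl
  · obtain ⟨a, m, M, c, ha, hc, rfl⟩ := exists_eq_smul_lowPolyVal hx hx0
    refine dense_iff_inter_open.2 fun V hV ⟨y, hy⟩ => ?_
    obtain ⟨N, hN, hmem⟩ := hhit m M c hc l _ (hV.preimage (continuous_const_smul a))
      ⟨a⁻¹ • y, by simpa [Set.mem_preimage, smul_smul, ha] using hy⟩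
    exact ⟨_, by rw [Set.mem_preimage, ← hsmul] at hmem; exact hmem, N, hN, rfl⟩
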